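/- Let $S$ be a countable left cancellative monoid with identity $e$. Let $I_\ell(S)$ be its left inverse hull, i.e. the inverse semigroup of partial bijections of $S$ generated by the left translations $t\mapsto st$ ($s\in S$); we identify $s\in S$ with the corresponding left translation, write $s^{-1}$ for the inverse partial bijection $sS\to S$, and write $0$ for the map with empty domain (if it belongs to $I_\ell(S)$). Every element of $I_\ell(S)$ has the form $s_1^{-1}t_1\cdots s_n^{-1}t_n$ with $s_i,t_i\in S$. Let $\mathcal J(S)$ be the set of constructible right ideals $X=s_1^{-1}t_1\cdots s_n^{-1}t_nS$ of $S$, and for $X\in\mathcal J(S)$ let $p_X\in I_\ell(S)$ be the identity map of $X$; the $p_X$ are exactly the elements of the semigroup $E(S)$ of idempotents of $I_\ell(S)$. Let $\widehat{E(S)}$ be the space of nonzero multiplicative maps $\chi\colon E(S)\to\{0,1\}$ with the topology of pointwise convergence, let $\chi_s(p_X)=\mathbf 1_X(s)$ for $s\in S$, and let $\Omega(S)=\overline{\{\chi_s: s\in S\}}\subset\widehat{E(S)}$. Let $\mathcal G(I_\ell(S))$ be the Paterson groupoid: the set of classes $[g,\chi]$ of pairs $(g,\chi)\in I_\ell(S)\times\widehat{E(S)}$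 with $\chi(g^{-1}g)=1$, where $[g_1,\chi_1]=[g_2,\chi_2]$ iff $\chi_1=\chi_2$ and $g_1p=g_2p$ for some $p\in E(S)$ with $\chi_1(p)=1$; its operations are $[g,\chi][h,\psi]=[gh,\psi]$ if $\chi=\psi(h^{-1}\cdot h)$, and $[g,\chi]^{-1}=[g^{-1},\chi(g^{-1}\cdot g)]$; its source and range maps are $[g,\chi]\mapsto\chi$ and $[g,\chi]\mapsto\chi(g^{-1}\cdot g)$; and its topology has as a basis the sets $D(g,U)=\{[g,\chi]:\chi\in U\}$, with $U$ open in $\{\chi:\chi(g^{-1}g)=1\}$. Let $\mathcal G_P(S)$ be its reduction to the closed invariant set $\Omega(S)$, and let $D(g,\Omega(S))\subset\mathcal G_P(S)$ be the set of all classes $[g,\chi]$ with $\chi\in\Omega(S)$ and $\chi(g^{-1}g)=1$. Let $C^*(\mathcal G_P(S))$ be its full C$^*$-algebra, i.e. the C$^*$-enveloping algebra of the convolution $*$-algebra $C_c(\mathcal G_P(S))$, which is the linear span of the functions that are continuous with compact support on some open Hausdorff subset and zero outside it. Put $v_s=\mathbf 1_{D(s,\Omega(S))}\in C^*(\mathcal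 G_P(S))$ for $s\in S$. Then $C^*(\mathcal G_P(S))$ is the universal unital C$^*$-algebra generated by the elements $v_s$, $s\in S$, subject to the relations (R1) $v_e=1$; (R2) for every $g=s_1^{-1}t_1\cdots s_n^{-1}t_n\in I_\ell(S)$, the element $v_g:=v_{s_1}^*v_{t_1}\cdots v_{s_n}^*v_{t_n}$ is independent of the presentation of $g$; (R3) if $0\in I_\ell(S)$, then $v_0=0$; (R4) if $X=X_1\cup\dots\cup X_n$ for some $n\ge1$ and $X,X_1,\dots,X_n\in\mathcal J(S)$, then $\prod_{i=1}^n(v_{p_X}-v_{p_{X_i}})=0$. That is: the elements $v_s$ satisfy (R1)–(R4); they generate $C^*(\mathcal G_P(S))$ as a C$^*$-algebra; and for every unital C$^*$-algebra $B$ and all elements $b_s\in B$, $s\in S$, satisfying (R1)–(R4), there is a unique unital $*$-homomorphism $\varphi\colon C^*(\mathcal G_P(S))\to B$ with $\varphi(v_s)=b_s$ for all $s\in S$. -/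

import Mathlib

/-! ### C*-seminorms and the C*-enveloping algebra of a unital *-algebra -/

section Envelope

universe u

/-- A C*-seminorm on a unital complex *-algebra. -/
structure CStarSeminorm (A : Type u) [Ring A] [StarRing A] [Algebra ℂ A] extends
    Seminorm ℂ A where
  mul_le' : ∀ a b : A, toFun (a * b) ≤ toFun a * toFun b
  star_mul_self' : ∀ a : A, toFun (star a * a) = toFun a * toFun a

namespace CStarSeminorm

variable {A : Type u} [Ring A] [StarRing A] [Algebra ℂ A]

noncomputable instance : CoeFun (CStarSeminorm A) (fun _ => A → ℝ) := ⟨fun p => p.toSeminorm⟩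

theorem mul_le (p : CStarSeminorm A) (a b : A) : p (a * b) ≤ p a * p b := p.mul_le' a b

theorem star_mul_self (p : CStarSeminorm A) (a : A) : p (star a * a) = p a * p a :=
  p.star_mul_self' a

theorem nonneg (p : CStarSeminorm A) (a : A) : 0 ≤ p a := apply_nonneg p.toSeminorm a

theorem le_star (p : CStarSeminorm A) (a : A) : p a ≤ p (star a) := by
  rcases (p.nonneg a).eq_or_lt with h | h
  · rw [← h]; exact p.nonneg _
  · have := p.mul_le (star a) a
    rw [p.star_mul_self] at this
    exact le_of_mul_le_mul_right this h

theorem star_eq (p : CStarSeminorm A) (a : A) : p (star a) = p a :=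
  le_antisymm (by simpa using p.le_star (star a)) (p.le_star a)

/-- The algebra `A` carrying the topology of the C*-seminorm `p`. -/
def Carrier (_ : CStarSeminorm A) : Type u := A

variable (p : CStarSeminorm A)

instance : Ring p.Carrier := inferInstanceAs (Ring A)
instance : StarRing p.Carrier := inferInstanceAs (StarRing A)
instance : Algebra ℂ p.Carrier := inferInstanceAs (Algebra ℂ A)

noncomputable instance : SeminormedRing p.Carrier :=
  { (inferInstance : Ring p.Carrier),
    (AddGroupSeminorm.toSeminormedAddCommGroup
      (show AddGroupSeminorm p.Carrier from p.toSeminorm.toAddGroupSeminorm)) with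
    norm_mul_le := p.mul_le }

theorem norm_carrier (a : p.Carrier) : ‖a‖ = p (show A from a) := rfl

noncomputable instance : NormedSpace ℂ p.Carrier where
  norm_smul_le c a := (map_smul_eq_mul p.toSeminorm c (show A from a)).le

theorem norm_star_carrier (a : p.Carrier) : ‖star a‖ = ‖a‖ := p.star_eq a

theorem isometry_star : Isometry (star : p.Carrier → p.Carrier) :=
  AddMonoidHomClass.isometry_of_norm (starAddEquiv : p.Carrier ≃+ p.Carrier) p.norm_star_carrier

/-- The Hausdorff completion of `A` with respect to the C*-seminorm `p`. -/
def Completion : Type u := UniformSpace.Completion p.Carrier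

noncomputable instance : NormedRing p.Completion :=
  inferInstanceAs (NormedRing (UniformSpace.Completion p.Carrier))

instance : CompleteSpace p.Completion :=
  inferInstanceAs (CompleteSpace (UniformSpace.Completion p.Carrier))

noncomputable instance : Algebra ℂ p.Completion :=
  inferInstanceAs (Algebra ℂ (UniformSpace.Completion p.Carrier))

/-- The canonical map into the completion. -/
noncomputable def coe (a : A) : p.Completion :=
  ((show p.Carrier from a : p.Carrier) : UniformSpace.Completion p.Carrier)

theorem norm_coe (a : A) : ‖p.coe a‖ = p a := 
  UniformSpace.Completion.norm_coe (E := p.Carrier) a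

theorem continuous_coe : Continuous (fun a : p.Carrier => p.coe a) :=
  UniformSpace.Completion.continuous_coe p.Carrier

theorem denseRange_coe : DenseRange (fun a : p.Carrier => p.coe a) :=
  UniformSpace.Completion.denseRange_coe (α := p.Carrier)

theorem induction {P : p.Completion → Prop} (x : p.Completion) (hc : IsClosed {x | P x})
    (h : ∀ a : A, P (p.coe a)) : P x :=
  UniformSpace.Completion.induction_on (α := p.Carrier) x hc h

theorem coe_add (a b : A) : p.coe (a + b) = p.coe a + p.coe b :=
  UniformSpace.Completion.coe_add (α := p.Carrier) a b

theorem coe_mul (a b : A) : p.coe (a * b) = p.coe a * p.coe b :=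
  UniformSpace.Completion.coe_mul (α := p.Carrier) a b

theorem coe_one : p.coe 1 = 1 := UniformSpace.Completion.coe_one p.Carrier

theorem coe_zero : p.coe 0 = 0 := UniformSpace.Completion.coe_zero (α := p.Carrier)

theorem coe_smul (c : ℂ) (a : A) : p.coe (c • a) = c • p.coe a :=
  UniformSpace.Completion.coe_smul (X := p.Carrier) c a

noncomputable instance : NormedAlgebra ℂ p.Completion where
  norm_smul_le c x := by
    refine norm_smul_le (α := ℂ) (β := UniformSpace.Completion p.Carrier) c x

noncomputable instance : Star p.Completion where
  star := UniformSpace.Completion.map (star : p.Carrier → p.Carrier)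

theorem coe_star (a : A) : p.coe (star a) = star (p.coe a) :=
  (UniformSpace.Completion.map_coe p.isometry_star.uniformContinuous (show p.Carrier from a)).symm

theorem continuous_star : Continuous (star : p.Completion → p.Completion) :=
  UniformSpace.Completion.continuous_map

noncomputable instance : StarRing p.Completion where
  star_involutive x := by
    refine p.induction (P := fun x => star (star x) = x) x
      (isClosed_eq (p.continuous_star.comp p.continuous_star) continuous_id) fun a => ?_
    rw [← coe_star, ← coe_star, star_star]
  star_mul x y := by
    refine p.induction (P := fun x => star (x * y) = star y * star x) x
      (isClosed_eq (p.continuous_star.comp (continuous_mul_const y))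
        (p.continuous_star.const_mul _)) fun a => ?_
    refine p.induction (P := fun y => star (p.coe a * y) = star y * star (p.coe a)) y
      (isClosed_eq (p.continuous_star.comp (continuous_const_mul _))
        (p.continuous_star.mul_const _)) fun b => ?_
    rw [← coe_mul, ← coe_star, ← coe_star, ← coe_star, ← coe_mul, star_mul]
  star_add x y := by
    refine p.induction (P := fun x => star (x + y) = star x + star y) x
      (isClosed_eq (p.continuous_star.comp (continuous_add_const y))
        (p.continuous_star.add continuous_const)) fun a => ?_
    refine p.induction (P := fun y => star (p.coe a + y) = star (p.coe a) + star y) y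
      (isClosed_eq (p.continuous_star.comp (continuous_const_add _))
        (continuous_const.add p.continuous_star)) fun b => ?_
    rw [← coe_add, ← coe_star, ← coe_star, ← coe_star, ← coe_add, star_add]

noncomputable instance [StarModule ℂ A] : CStarAlgebra p.Completion where
  norm_mul_self_le x := by
    refine p.induction (P := fun x => ‖x‖ * ‖x‖ ≤ ‖star x * x‖) x
      (isClosed_le (continuous_norm.mul continuous_norm)
        (continuous_norm.comp (p.continuous_star.mul continuous_id))) fun a => ?_
    rw [← coe_star, ← coe_mul, norm_coe, norm_coe, star_mul_self]
  star_smul c x := by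
    refine p.induction (P := fun x => star (c • x) = star c • star x) x
      (isClosed_eq (p.continuous_star.comp (continuous_const_smul c))
        ((continuous_const_smul (star c)).comp p.continuous_star)) fun a => ?_
    rw [← coe_smul, ← coe_star, ← coe_star, ← coe_smul, star_smul]

/-- The canonical unital *-homomorphism into the completion. -/
noncomputable def toCompletion [StarModule ℂ A] : A →⋆ₐ[ℂ] p.Completion where
  toFun := p.coe
  map_one' := p.coe_one
  map_mul' := p.coe_mul
  map_zero' := p.coe_zero
  map_add' := p.coe_add
  commutes' c := by
    rw [Algebra.algebraMap_eq_smul_one, Algebra.algebraMap_eq_smul_one, coe_smul, coe_one]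
  map_star' := p.coe_star

/-- Every C*-seminorm on a C*-algebra is dominated by the norm. -/
theorem le_norm {D : Type u} [CStarAlgebra D] (q : CStarSeminorm D) (a : D) : q a ≤ ‖a‖ := by
  rw [← q.norm_coe]
  exact NonUnitalStarAlgHom.norm_apply_le q.toCompletion a

/-- The zero C*-seminorm. -/
noncomputable instance : Inhabited (CStarSeminorm A) :=
  ⟨{ (0 : Seminorm ℂ A) with
      mul_le' := fun _ _ => (mul_zero (0 : ℝ)).ge
      star_mul_self' := fun _ => (mul_zero (0 : ℝ)).symm }⟩

end CStarSeminorm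

/-- Every element of the *-algebra `A` is uniformly bounded over all C*-seminorms on `A`
(equivalently, over all *-representations by bounded operators on Hilbert spaces). -/
class HasCStarEnvelope (A : Type u) [Ring A] [StarRing A] [Algebra ℂ A] : Prop where
  bddAbove : ∀ a : A, BddAbove (Set.range fun p : CStarSeminorm A => p a)

section

variable (A : Type u) [Ring A] [StarRing A] [Algebra ℂ A] [HasCStarEnvelope A]

variable {A} in
theorem CStarSeminorm.le_iSup (p : CStarSeminorm A) (a : A) :
    p a ≤ ⨆ q : CStarSeminorm A, q a :=
  le_ciSup (HasCStarEnvelope.bddAbove a) p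

/-- The largest C*-seminorm on `A`. -/
noncomputable def maxCStarSeminorm : CStarSeminorm A where
  toFun a := ⨆ p : CStarSeminorm A, p a
  map_zero' := by simp
  add_le' a b := ciSup_le fun p =>
    (map_add_le_add p.toSeminorm a b).trans (add_le_add (p.le_iSup a) (p.le_iSup b))
  neg' a := by simp
  smul' c a := by
    simp only [map_smul_eq_mul]
    exact (Real.mul_iSup_of_nonneg (norm_nonneg c) _).symm
  mul_le' a b := ciSup_le fun p =>
    (p.mul_le a b).trans (mul_le_mul (p.le_iSup a) (p.le_iSup b) (p.nonneg b)
      ((p.nonneg a).trans (p.le_iSup a)))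
  star_mul_self' a := by
    have h0 : 0 ≤ ⨆ p : CStarSeminorm A, p a := Real.iSup_nonneg fun p => p.nonneg a
    apply le_antisymm
    · refine ciSup_le fun p => ?_
      rw [p.star_mul_self]
      exact mul_le_mul (p.le_iSup a) (p.le_iSup a) (p.nonneg a) h0
    · rw [← Real.sqrt_le_sqrt_iff (Real.iSup_nonneg fun p => p.nonneg _), Real.sqrt_mul_self h0]
      refine ciSup_le fun p => Real.le_sqrt_of_sq_le ?_
      rw [sq, ← p.star_mul_self]
      exact p.le_iSup _

/-- The C*-enveloping algebra of `A`: the Hausdorff completion in the largest C*-seminorm. -/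
abbrev CStarEnvelope : Type u := (maxCStarSeminorm A).Completion

/-- The canonical unital *-homomorphism of `A` into its C*-enveloping algebra. -/
noncomputable abbrev CStarEnvelope.of [StarModule ℂ A] : A →⋆ₐ[ℂ] CStarEnvelope A :=
  (maxCStarSeminorm A).toCompletion

end

end Envelope

/-! ### The left inverse hull and its semi-characters -/

section Hull

universe u

variable {S : Type u} [LeftCancelMonoid S]

open Classical in
/-- The left translation `t ↦ s * t`, as a partial bijection of `S` with domain `S` and
image `sS`. -/
noncomputable def leftTranslation (s : S) : S ≃. S where
  toFun t := some (s * t)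
  invFun x := if h : ∃ t, s * t = x then some h.choose else none
  inv t x := by
    by_cases h : ∃ t, s * t = x
    · simp only [h, dite_true, Option.some.injEq]
      constructor
      · intro ht; rw [← ht]; exact h.choose_spec
      · intro ht; exact mul_left_cancel (h.choose_spec.trans ht.symm)
    · simp only [h, dite_false, Option.some.injEq]
      constructor
      · intro ht; cases ht
      · intro ht; exact absurd ⟨t, ht⟩ h

theorem mem_leftTranslation {s t x : S} : x ∈ leftTranslation s t ↔ s * t = x := by
  simp [leftTranslation]

/-- Membership in the inverse semigroup of partial bijections generated by the left
translations. -/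
inductive InLeftHull : (S ≃. S) → Prop
  | translation (s : S) : InLeftHull (leftTranslation s)
  | symm {f : S ≃. S} : InLeftHull f → InLeftHull f.symm
  | trans {f g : S ≃. S} : InLeftHull f → InLeftHull g → InLeftHull (f.trans g)

variable (S) in
/-- The left inverse hull of `S`. -/
def LeftHull : Type u := {f : S ≃. S // InLeftHull f}

namespace LeftHull

theorem refl_mem : InLeftHull (PEquiv.refl S) := by
  have : leftTranslation (1 : S) = PEquiv.refl S := by
    ext t x
    simp [leftTranslation]
  exact this ▸ InLeftHull.translation 1

/-- The product `g * h` is the composition of partial maps `g ∘ h`. -/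
noncomputable instance : Monoid (LeftHull S) where
  mul g h := ⟨h.1.trans g.1, h.2.trans g.2⟩
  one := ⟨PEquiv.refl S, refl_mem⟩
  mul_assoc f g h := Subtype.ext (PEquiv.trans_assoc h.1 g.1 f.1).symm
  one_mul f := Subtype.ext (PEquiv.trans_refl f.1)
  mul_one f := Subtype.ext (PEquiv.refl_trans f.1)

noncomputable instance : Inv (LeftHull S) where
  inv g := ⟨g.1.symm, g.2.symm⟩

/-- The left translation by `s` as an element of the left inverse hull. -/
noncomputable def tr (s : S) : LeftHull S := ⟨leftTranslation s, .translation s⟩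

@[ext] theorem ext {g h : LeftHull S} (H : ∀ x y, y ∈ g.1 x ↔ y ∈ h.1 x) : g = h :=
  Subtype.ext (PEquiv.ext fun x => Option.ext fun y => H x y)

theorem mem_mul {g h : LeftHull S} {x y : S} :
    y ∈ (g * h).1 x ↔ ∃ z, z ∈ h.1 x ∧ y ∈ g.1 z := PEquiv.mem_trans h.1 g.1 x y

theorem mem_one {x y : S} : y ∈ (1 : LeftHull S).1 x ↔ x = y := by
  change some x = some y ↔ _
  simp

theorem mem_inv {g : LeftHull S} {x y : S} : y ∈ (g⁻¹).1 x ↔ x ∈ g.1 y := PEquiv.mem_iff_mem g.1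

theorem val_inj {g : LeftHull S} {x y z : S} (h : z ∈ g.1 x) (h' : z ∈ g.1 y) : x = y :=
  PEquiv.inj g.1 h h'

theorem val_unique {g : LeftHull S} {x y z : S} (h : y ∈ g.1 x) (h' : z ∈ g.1 x) : y = z :=
  Option.mem_unique h h'

theorem inv_inv' (g : LeftHull S) : g⁻¹⁻¹ = g := rfl

theorem mul_inv' (g h : LeftHull S) : (g * h)⁻¹ = h⁻¹ * g⁻¹ := rfl

theorem isIdempotentElem_iff {p : LeftHull S} :
    IsIdempotentElem p ↔ ∀ x y, y ∈ p.1 x → x = y := by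
  constructor
  · intro hp x y hxy
    have h2 : y ∈ (p * p).1 x := by rw [hp.eq]; exact hxy
    obtain ⟨z, hz, hy⟩ := mem_mul.1 h2
    have : z = y := val_unique hz hxy
    subst this
    exact val_inj hz hy
  · intro hp
    ext x y
    rw [mem_mul]
    constructor
    · rintro ⟨z, hz, hy⟩
      obtain rfl := hp _ _ hz
      exact hy
    · intro h
      obtain rfl := hp _ _ h
      exact ⟨x, h, h⟩

end LeftHull

open LeftHull

variable (S) in
/-- The semigroup of idempotents of the left inverse hull. -/
def Idem : Type u := {p : LeftHull S // IsIdempotentElem p}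

namespace Idem

theorem eq_of_mem (p : Idem S) {x y : S} (h : y ∈ p.1.1 x) : x = y :=
  isIdempotentElem_iff.1 p.2 x y h

theorem ext' {p q : Idem S} (H : ∀ x, x ∈ p.1.1 x ↔ x ∈ q.1.1 x) : p = q := by
  apply Subtype.ext
  ext x y
  constructor
  · intro h; obtain rfl := p.eq_of_mem h; exact (H x).1 h
  · intro h; obtain rfl := q.eq_of_mem h; exact (H x).2 h

noncomputable instance : Mul (Idem S) where
  mul p q := ⟨p.1 * q.1, isIdempotentElem_iff.2 fun x y h => by
    obtain ⟨z, hz, hy⟩ := mem_mul.1 h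
    obtain rfl := q.eq_of_mem hz
    exact p.eq_of_mem hy⟩

noncomputable instance : One (Idem S) := ⟨⟨1, mul_one 1⟩⟩

theorem mem_mul_iff {p q : Idem S} {x : S} :
    x ∈ (p * q).1.1 x ↔ x ∈ p.1.1 x ∧ x ∈ q.1.1 x := by
  change x ∈ (p.1 * q.1).1 x ↔ _
  rw [mem_mul]
  constructor
  · rintro ⟨z, hz, hx⟩
    obtain rfl := q.eq_of_mem hz
    exact ⟨hx, hz⟩
  · rintro ⟨h, h'⟩; exact ⟨x, h', h⟩

theorem mem_one_iff {x : S} : x ∈ (1 : Idem S).1.1 x := mem_one.2 rfl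

theorem mul_comm' (p q : Idem S) : p * q = q * p :=
  ext' fun x => by rw [mem_mul_iff, mem_mul_iff, and_comm]

theorem one_mul' (p : Idem S) : 1 * p = p :=
  ext' fun x => by rw [mem_mul_iff]; exact ⟨fun h => h.2, fun h => ⟨mem_one_iff, h⟩⟩

/-- The idempotent `g⁻¹ p g`. -/
noncomputable def conj (g : LeftHull S) (p : Idem S) : Idem S :=
  ⟨g⁻¹ * p.1 * g, isIdempotentElem_iff.2 fun x y h => by
    obtain ⟨z, hz, hy⟩ := mem_mul.1 h
    obtain ⟨w, hw, hy⟩ := mem_mul.1 hy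
    obtain rfl := p.eq_of_mem hw
    exact val_inj hz (mem_inv.1 hy)⟩

theorem mem_conj {g : LeftHull S} {p : Idem S} {x : S} :
    x ∈ (conj g p).1.1 x ↔ ∃ y, y ∈ g.1 x ∧ y ∈ p.1.1 y := by
  change x ∈ (g⁻¹ * p.1 * g).1 x ↔ _
  rw [mem_mul]
  constructor
  · rintro ⟨z, hz, h⟩
    obtain ⟨w, hw, h⟩ := mem_mul.1 h
    obtain rfl := p.eq_of_mem hw
    exact ⟨z, hz, hw⟩
  · rintro ⟨y, hy, h⟩
    exact ⟨y, hy, mem_mul.2 ⟨y, h, mem_inv.2 hy⟩⟩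

/-- The source idempotent `g⁻¹ g`, the identity map of the domain of `g`. -/
noncomputable def dom (g : LeftHull S) : Idem S :=
  ⟨g⁻¹ * g, isIdempotentElem_iff.2 fun x y h => by
    obtain ⟨z, hz, hy⟩ := mem_mul.1 h
    exact val_inj hz (mem_inv.1 hy)⟩

theorem mem_dom {g : LeftHull S} {x : S} : x ∈ (dom g).1.1 x ↔ ∃ y, y ∈ g.1 x := by
  change x ∈ (g⁻¹ * g).1 x ↔ _
  rw [mem_mul]
  exact ⟨fun ⟨z, hz, _⟩ => ⟨z, hz⟩, fun ⟨z, hz⟩ => ⟨z, hz, mem_inv.2 hz⟩⟩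

theorem conj_one (g : LeftHull S) : conj g 1 = dom g :=
  ext' fun x => by
    rw [mem_conj, mem_dom]
    exact ⟨fun ⟨y, hy, _⟩ => ⟨y, hy⟩, fun ⟨y, hy⟩ => ⟨y, hy, mem_one_iff⟩⟩

theorem conj_mul' (g : LeftHull S) (p q : Idem S) : conj g (p * q) = conj g p * conj g q :=
  ext' fun x => by
    rw [mem_mul_iff, mem_conj, mem_conj, mem_conj]
    constructor
    · rintro ⟨y, hy, h⟩
      exact ⟨⟨y, hy, (mem_mul_iff.1 h).1⟩, ⟨y, hy, (mem_mul_iff.1 h).2⟩⟩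
    · rintro ⟨⟨y, hy, h⟩, ⟨z, hz, h'⟩⟩
      obtain rfl := val_unique hy hz
      exact ⟨y, hy, mem_mul_iff.2 ⟨h, h'⟩⟩

theorem conj_conj (g h : LeftHull S) (p : Idem S) : conj h (conj g p) = conj (g * h) p :=
  ext' fun x => by
    simp only [mem_conj, mem_mul]
    constructor
    · rintro ⟨y, hy, z, hz, h⟩; exact ⟨z, ⟨y, hy, hz⟩, h⟩
    · rintro ⟨z, ⟨y, hy, hz⟩, h⟩; exact ⟨y, hy, z, hz, h⟩

theorem conj_dom (g h : LeftHull S) : conj h (dom g) = dom (g * h) := by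
  rw [← conj_one, ← conj_one, conj_conj]

theorem dom_idem (p : Idem S) : dom p.1 = p := ext' fun x => by
  rw [mem_dom]
  exact ⟨fun ⟨y, hy⟩ => by have := p.eq_of_mem hy; subst this; exact hy, fun h => ⟨x, h⟩⟩

theorem conj_idem (p q : Idem S) : conj p.1 q = p * q := ext' fun x => by
  rw [mem_conj, mem_mul_iff]
  constructor
  · rintro ⟨y, hy, h⟩
    obtain rfl := p.eq_of_mem hy
    exact ⟨hy, h⟩
  · rintro ⟨h, h'⟩; exact ⟨x, h, h'⟩

/-- If `g` and `h` agree on the idempotent `p`, then so do their conjugations. -/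
theorem conj_mul_congr {g h : LeftHull S} {p : Idem S} (H : g * p.1 = h * p.1) (q : Idem S) :
    p * conj g q = p * conj h q := by
  rw [← conj_idem, ← conj_idem, conj_conj, conj_conj, H]

theorem dom_mul_congr {g h : LeftHull S} {p : Idem S} (H : g * p.1 = h * p.1) :
    p * dom g = p * dom h := by
  rw [← conj_one, ← conj_one, conj_mul_congr H]

end Idem

open Idem

variable (S) in
/-- The set of semi-characters of the semigroup of idempotents: multiplicative maps to `{0,1}`
that are not identically zero. It carries the topology of pointwise convergence. -/
def semiChars : Set (Idem S → Bool) :=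
  {χ | (∀ p q, χ (p * q) = (χ p && χ q)) ∧ ∃ p, χ p = true}

namespace semiChars

theorem map_mul (χ : semiChars S) (p q : Idem S) : χ.1 (p * q) = (χ.1 p && χ.1 q) := χ.2.1 p q

theorem map_mul_iff (χ : semiChars S) (p q : Idem S) :
    χ.1 (p * q) = true ↔ χ.1 p = true ∧ χ.1 q = true := by
  rw [map_mul, Bool.and_eq_true]

theorem map_one (χ : semiChars S) : χ.1 1 = true := by
  obtain ⟨p, hp⟩ := χ.2.2
  rw [← one_mul' p, map_mul_iff] at hp
  exact hp.1

theorem ext' {χ ψ : semiChars S} (h : ∀ p, χ.1 p = true ↔ ψ.1 p = true) : χ = ψ :=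
  Subtype.ext (funext fun p => Bool.eq_iff_iff.2 (h p))

theorem isClosed : IsClosed (semiChars S) := by
  have : semiChars S = (⋂ p, ⋂ q, {χ : Idem S → Bool | χ (p * q) = (χ p && χ q)}) ∩
      {χ | χ 1 = true} := by
    ext χ
    constructor
    · intro h
      refine ⟨?_, map_one ⟨χ, h⟩⟩
      simp only [Set.mem_iInter]
      exact h.1
    · rintro ⟨h, h'⟩
      simp only [Set.mem_iInter] at h
      exact ⟨h, 1, h'⟩
  rw [this]
  refine IsClosed.inter (isClosed_iInter fun p => isClosed_iInter fun q => ?_) ?_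
  · refine isClosed_eq (continuous_apply _) ?_
    have h1 : Continuous fun χ : Idem S → Bool => (χ p, χ q) :=
      (continuous_apply p).prodMk (continuous_apply q)
    have h2 : Continuous fun x : Bool × Bool => (x.1 && x.2) := continuous_of_discreteTopology
    exact h2.comp h1
  · exact isClosed_eq (continuous_apply _) continuous_const

/-- The semi-character `χ(g⁻¹ · g)`. -/
noncomputable def act (g : LeftHull S) (χ : semiChars S) (h : χ.1 (dom g) = true) : semiChars S :=
  ⟨fun p => χ.1 (conj g p), fun p q => by simp only [conj_mul', map_mul], 1,
    by simp only [conj_one, h]⟩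

/-- The semi-character `χ_s`, with `χ_s(p_X) = 1` if and only if `s ∈ X`. -/
noncomputable def point (s : S) : semiChars S :=
  ⟨fun p => (p.1.1 s).isSome, fun p q => by
    have key : ∀ r : Idem S, (r.1.1 s).isSome = true ↔ s ∈ r.1.1 s := fun r => by
      rw [Option.isSome_iff_exists]
      exact ⟨fun ⟨y, hy⟩ => by obtain rfl := r.eq_of_mem hy; exact hy, fun h => ⟨s, h⟩⟩
    rw [Bool.eq_iff_iff, Bool.and_eq_true, key, key, key, mem_mul_iff], 1, rfl⟩

theorem point_iff {s : S} {p : Idem S} : (point s).1 p = true ↔ s ∈ p.1.1 s := by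
  change (p.1.1 s).isSome = true ↔ _
  rw [Option.isSome_iff_exists]
  exact ⟨fun ⟨y, hy⟩ => by obtain rfl := p.eq_of_mem hy; exact hy, fun h => ⟨s, h⟩⟩

theorem act_apply {g : LeftHull S} {χ : semiChars S} (h : χ.1 (dom g) = true) (p : Idem S) :
    (act g χ h).1 p = χ.1 (conj g p) := rfl

theorem act_congr {g h : LeftHull S} {χ : semiChars S} (hg : χ.1 (dom g) = true)
    (hh : χ.1 (dom h) = true) {p : Idem S} (H : g * p.1 = h * p.1) (hp : χ.1 p = true) :
    act g χ hg = act h χ hh := by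
  refine ext' fun q => ?_
  rw [act_apply, act_apply]
  have := congrArg χ.1 (conj_mul_congr H q)
  rw [map_mul, map_mul, hp, Bool.true_and, Bool.true_and] at this
  rw [this]

theorem dom_mul_iff (g h : LeftHull S) (χ : semiChars S) : χ.1 (dom (g * h)) = true ↔
    ∃ hh : χ.1 (dom h) = true, (act h χ hh).1 (dom g) = true := by
  have e : dom (g * h) = dom h * dom (g * h) := by
    rw [← conj_dom, ← conj_one h, ← conj_mul', one_mul']
  constructor
  · intro H
    have H' := H
    rw [e, map_mul_iff] at H'
    exact ⟨H'.1, by rw [act_apply, conj_dom, H]⟩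
  · rintro ⟨hh, H⟩
    rwa [act_apply, conj_dom] at H

theorem act_act {g h : LeftHull S} {χ : semiChars S} (hh : χ.1 (dom h) = true)
    (hg : (act h χ hh).1 (dom g) = true) (hgh : χ.1 (dom (g * h)) = true) :
    act g (act h χ hh) hg = act (g * h) χ hgh :=
  ext' fun p => by rw [act_apply, act_apply, act_apply, conj_conj]

theorem act_idem (p : Idem S) (χ : semiChars S) (h : χ.1 (dom p.1) = true) :
    act p.1 χ h = χ := ext' fun q => by
  rw [dom_idem] at h
  rw [act_apply, conj_idem, map_mul_iff]
  exact ⟨fun H => H.2, fun H => ⟨h, H⟩⟩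

theorem dom_inv_act {g : LeftHull S} {χ : semiChars S} (h : χ.1 (dom g) = true) :
    (act g χ h).1 (dom g⁻¹) = true := by
  rw [act_apply, conj_dom]
  have : dom (g⁻¹ * g) = dom g := dom_idem (dom g)
  rw [this, h]

theorem act_inv_act {g : LeftHull S} {χ : semiChars S} (h : χ.1 (dom g) = true) :
    act g⁻¹ (act g χ h) (dom_inv_act h) = χ := by
  have h2 : χ.1 (dom (g⁻¹ * g)) = true := (dom_mul_iff _ _ _).2 ⟨h, dom_inv_act h⟩
  rw [act_act h (dom_inv_act h) h2]
  exact act_idem (dom g) χ h2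

theorem act_point {g : LeftHull S} {s t : S} (hs : t ∈ g.1 s)
    (h : (point s).1 (dom g) = true) : act g (point s) h = point t := ext' fun p => by
  rw [act_apply, point_iff, point_iff, mem_conj]
  constructor
  · rintro ⟨y, hy, hp⟩; obtain rfl := val_unique hy hs; exact hp
  · intro hp; exact ⟨t, hs, hp⟩

theorem isClopen_eval (p : Idem S) : IsClopen {χ : semiChars S | χ.1 p = true} :=
  (isClopen_discrete {true}).preimage ((continuous_apply p).comp continuous_subtype_val)

theorem continuous_act (g : LeftHull S) :
    Continuous fun χ : {χ : semiChars S | χ.1 (dom g) = true} => act g χ.1 χ.2 := by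
  refine Continuous.subtype_mk (continuous_pi fun p => ?_) _
  exact (continuous_apply (conj g p)).comp (continuous_subtype_val.comp continuous_subtype_val)

variable (S) in
/-- The closed set `Ω(S)`: the closure of the set of semi-characters `χ_s`, `s ∈ S`, which is
the orbit of `χ_e` under the left inverse hull. -/
def omega : Set (semiChars S) := closure (Set.range point)

theorem act_mem_omega {g : LeftHull S} {χ : semiChars S} (h : χ.1 (dom g) = true)
    (hχ : χ ∈ omega S) : act g χ h ∈ omega S := by
  rw [omega, mem_closure_iff]
  intro O hO hmem
  obtain ⟨W, hW, hWO⟩ := isOpen_induced_iff.1 (hO.preimage (continuous_act g))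
  have hχW : χ ∈ W ∩ {χ : semiChars S | χ.1 (dom g) = true} := by
    refine ⟨?_, h⟩
    have : (⟨χ, h⟩ : {χ : semiChars S | χ.1 (dom g) = true}) ∈ Subtype.val ⁻¹' W := by
      rw [hWO]; exact hmem
    exact this
  obtain ⟨_, ⟨hsW, hsd⟩, s, rfl⟩ :=
    mem_closure_iff.1 hχ _ (hW.inter (isClopen_eval (dom g)).isOpen) hχW
  have hsd' : (point s).1 (dom g) = true := hsd
  have : (⟨point s, hsd'⟩ : {χ : semiChars S | χ.1 (dom g) = true}) ∈ Subtype.val ⁻¹' W := hsW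
  rw [hWO] at this
  obtain ⟨t, ht⟩ := mem_dom.1 (point_iff.1 hsd')
  exact ⟨_, this, t, (act_point ht hsd').symm⟩

end semiChars

end Hull

/-! ### The Paterson groupoid of the left inverse hull and its reduction to `Ω(S)` -/

section Groupoid

universe u

variable {S : Type u} [LeftCancelMonoid S]

open LeftHull Idem semiChars

variable (S) in
/-- The set of pairs `(g, χ)` with `χ(g⁻¹ g) = 1`. -/
def GermPair : Type u := {x : LeftHull S × semiChars S // x.2.1 (dom x.1) = true}

variable (S) in
/-- The equivalence relation defining germs: `(g₁, χ₁) ∼ (g₂, χ₂)` if `χ₁ = χ₂` and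
`g₁ p = g₂ p` for some idempotent `p` with `χ₁(p) = 1`. -/
def germSetoid : Setoid (GermPair S) where
  r x y := x.1.2 = y.1.2 ∧ ∃ p : Idem S, x.1.1 * p.1 = y.1.1 * p.1 ∧ x.1.2.1 p = true
  iseqv :=
    { refl := fun x => ⟨rfl, 1, rfl, map_one _⟩
      symm := fun ⟨h, p, hp, hx⟩ => ⟨h.symm, p, hp.symm, h ▸ hx⟩
      trans := by
        rintro x y z ⟨h, p, hp, hx⟩ ⟨h', q, hq, hy⟩
        refine ⟨h.trans h', p * q, ?_, (map_mul_iff _ _ _).2 ⟨hx, h ▸ hy⟩⟩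
        have e : (p * q).1 = p.1 * q.1 := rfl
        have e' : (p * q).1 = q.1 * p.1 := congrArg Subtype.val (Idem.mul_comm' p q)
        rw [e, ← mul_assoc, hp, mul_assoc, ← e, e', ← mul_assoc, hq, mul_assoc] }

variable (S) in
/-- The Paterson groupoid of the left inverse hull of `S`. -/
def Paterson : Type u := Quotient (germSetoid S)

namespace Paterson

/-- The class `[g, χ]`. -/
def germ (g : LeftHull S) (χ : semiChars S) (h : χ.1 (dom g) = true) : Paterson S :=
  Quotient.mk (germSetoid S) ⟨(g, χ), h⟩

theorem germ_eq_iff {g g' : LeftHull S} {χ χ' : semiChars S} {h : χ.1 (dom g) = true}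
    {h' : χ'.1 (dom g') = true} : germ g χ h = germ g' χ' h' ↔
      χ = χ' ∧ ∃ p : Idem S, g * p.1 = g' * p.1 ∧ χ.1 p = true :=
  Quotient.eq (r := germSetoid S)

theorem exists_germ (γ : Paterson S) : ∃ g χ h, γ = germ g χ h := by
  obtain ⟨⟨⟨g, χ⟩, h⟩, rfl⟩ := Quotient.exists_rep γ
  exact ⟨g, χ, h, rfl⟩

/-- The source map `[g, χ] ↦ χ`. -/
def src : Paterson S → semiChars S := Quotient.lift (fun x => x.1.2) fun _ _ h => h.1

/-- The range map `[g, χ] ↦ χ(g⁻¹ · g)`. -/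
noncomputable def rng : Paterson S → semiChars S :=
  Quotient.lift (fun x => act x.1.1 x.1.2 x.2) (by
    rintro ⟨⟨g, χ⟩, h⟩ ⟨⟨g', χ'⟩, h'⟩ ⟨e, p, hp, hx⟩
    obtain rfl : χ = χ' := e
    exact act_congr h h' hp hx)

theorem src_germ (g : LeftHull S) (χ : semiChars S) (h) : src (germ g χ h) = χ := rfl

theorem rng_germ (g : LeftHull S) (χ : semiChars S) (h) : rng (germ g χ h) = act g χ h := rfl

theorem inv_mul_congr {g h : LeftHull S} {p : Idem S} (H : g * p.1 = h * p.1) :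
    g⁻¹ * (conj g⁻¹ p).1 = h⁻¹ * (conj g⁻¹ p).1 := by
  have e : (conj g⁻¹ p).1 = g * p.1 * g⁻¹ := rfl
  have key : ∀ x y : S, x ∈ p.1.1 x → (y ∈ g.1 x ↔ y ∈ h.1 x) := fun x y hx => by
    have := congrArg (fun k : LeftHull S => y ∈ k.1 x) H
    simp only [mem_mul, eq_iff_iff] at this
    constructor
    · intro hy
      obtain ⟨z, hz, hy⟩ := this.1 ⟨x, hx, hy⟩
      obtain rfl := p.eq_of_mem hz
      exact hy
    · intro hy
      obtain ⟨z, hz, hy⟩ := this.2 ⟨x, hx, hy⟩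
      obtain rfl := p.eq_of_mem hz
      exact hy
  ext x y
  rw [mem_mul, mem_mul]
  refine exists_congr fun z => and_congr_right fun hz => ?_
  obtain rfl := (conj g⁻¹ p).eq_of_mem hz
  obtain ⟨w, hw, hwp⟩ := mem_conj.1 hz
  rw [mem_inv] at hw
  rw [mem_inv, mem_inv]
  have hw' := (key _ _ hwp).1 hw
  constructor
  · intro hy; obtain rfl := val_inj hw hy; exact hw'
  · intro hy; obtain rfl := val_inj hw' hy; exact hw

/-- The inverse `[g, χ] ↦ [g⁻¹, χ(g⁻¹ · g)]`. -/
noncomputable def inv : Paterson S → Paterson S :=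
  Quotient.lift (fun x => germ x.1.1⁻¹ (act x.1.1 x.1.2 x.2) (dom_inv_act x.2)) (by
    rintro ⟨⟨g, χ⟩, h⟩ ⟨⟨g', χ'⟩, h'⟩ ⟨e, p, hp, hx⟩
    obtain rfl : χ = χ' := e
    replace hp : g * p.1 = g' * p.1 := hp
    replace hx : χ.1 p = true := hx
    refine germ_eq_iff.2 ⟨act_congr h h' hp hx, conj g⁻¹ p, inv_mul_congr hp, ?_⟩
    change χ.1 (conj g (conj g⁻¹ p)) = true
    rw [conj_conj]
    change χ.1 (conj (dom g).1 p) = true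
    rw [conj_idem, map_mul_iff]
    exact ⟨h, hx⟩)

theorem inv_germ (g : LeftHull S) (χ : semiChars S) (h) :
    inv (germ g χ h) = germ g⁻¹ (act g χ h) (dom_inv_act h) := rfl

theorem src_inv (γ : Paterson S) : src (inv γ) = rng γ := by
  obtain ⟨g, χ, h, rfl⟩ := exists_germ γ
  rfl

theorem rng_inv (γ : Paterson S) : rng (inv γ) = src γ := by
  obtain ⟨g, χ, h, rfl⟩ := exists_germ γ
  exact act_inv_act h

theorem inv_inv (γ : Paterson S) : inv (inv γ) = γ := by
  obtain ⟨g, χ, h, rfl⟩ := exists_germ γ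
  exact germ_eq_iff.2 ⟨act_inv_act h, 1, rfl, map_one _⟩

theorem out_spec (γ : Paterson S) : ∃ h, γ = germ (Quotient.out γ).1.1 (src γ) h := by
  have e : germ (Quotient.out γ).1.1 (Quotient.out γ).1.2 (Quotient.out γ).2 = γ :=
    Quotient.out_eq γ
  have e2 : (Quotient.out γ).1.2 = src γ := congrArg src e
  refine ⟨e2 ▸ (Quotient.out γ).2, e.symm.trans ?_⟩
  exact germ_eq_iff.2 ⟨e2, 1, rfl, map_one _⟩

theorem dom_mul_out {a b : Paterson S} (h : src a = rng b) :
    (src b).1 (dom ((Quotient.out a).1.1 * (Quotient.out b).1.1)) = true := by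
  obtain ⟨ha, ea⟩ := out_spec a
  obtain ⟨hb, eb⟩ := out_spec b
  have e : src a = act _ _ hb := h.trans (congrArg rng eb)
  exact (dom_mul_iff _ _ _).2 ⟨hb, e ▸ ha⟩

/-- The product of composable elements: `[g, χ] [h, ψ] = [g h, ψ]` if `χ = ψ(h⁻¹ · h)`; see
`mul_germ` for independence of the representatives. -/
noncomputable def mul (a b : Paterson S) (h : src a = rng b) : Paterson S :=
  germ ((Quotient.out a).1.1 * (Quotient.out b).1.1) (src b) (dom_mul_out h)

theorem mul_germ {g h : LeftHull S} {χ ψ : semiChars S} (hg : χ.1 (dom g) = true)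
    (hh : ψ.1 (dom h) = true) (e : χ = act h ψ hh) (hgh : ψ.1 (dom (g * h)) = true) :
    mul (germ g χ hg) (germ h ψ hh) e = germ (g * h) ψ hgh := by
  obtain ⟨ha, ea⟩ := out_spec (germ g χ hg)
  obtain ⟨hb, eb⟩ := out_spec (germ h ψ hh)
  obtain ⟨-, p, hp, hpχ⟩ := germ_eq_iff.1 ea
  obtain ⟨-, q, hq, hqψ⟩ := germ_eq_iff.1 eb
  refine germ_eq_iff.2 ⟨rfl, q * conj h p, ?_, ?_⟩
  · set g' := (Quotient.out (germ g χ hg)).1.1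
    set h' := (Quotient.out (germ h ψ hh)).1.1
    have c : ∀ k : LeftHull S, k * (conj k p).1 = p.1 * k := fun k => by
      ext x y
      rw [mem_mul, mem_mul]
      constructor
      · rintro ⟨z, hz, hy⟩
        obtain rfl := (conj k p).eq_of_mem hz
        obtain ⟨w, hw, hwp⟩ := mem_conj.1 hz
        obtain rfl := val_unique hw hy
        exact ⟨w, hw, hwp⟩
      · rintro ⟨z, hz, hy⟩
        obtain rfl := p.eq_of_mem hy
        exact ⟨x, mem_conj.2 ⟨z, hz, hy⟩, hz⟩
    have e1 : (q * conj h p).1 = q.1 * (conj h p).1 := rfl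
    have e2 : (q * conj h p).1 = (conj h p).1 * q.1 := congrArg Subtype.val (Idem.mul_comm' _ _)
    calc g' * h' * (q * conj h p).1 = g' * (h' * q.1) * (conj h p).1 := by
          rw [e1]; simp only [mul_assoc]
      _ = g' * (h * q.1) * (conj h p).1 := by rw [hq]
      _ = g' * (h * (q * conj h p).1) := by rw [e1]; simp only [mul_assoc]
      _ = g' * (h * (conj h p).1) * q.1 := by rw [e2]; simp only [mul_assoc]
      _ = (g' * p.1) * h * q.1 := by rw [c]; simp only [mul_assoc]
      _ = (g * p.1) * h * q.1 := by rw [hp]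
      _ = g * (h * (conj h p).1) * q.1 := by rw [c]; simp only [mul_assoc]
      _ = g * h * (q * conj h p).1 := by rw [e2]; simp only [mul_assoc]
  · rw [src_germ, map_mul_iff]
    refine ⟨hqψ, ?_⟩
    rw [e] at hpχ
    exact hpχ

theorem src_mul (a b : Paterson S) (h : src a = rng b) : src (mul a b h) = src b := rfl

/-- `D(g, U)`: the set of all germs `[g, χ]` with `χ ∈ U`. -/
def basicSet (g : LeftHull S) (U : Set (semiChars S)) : Set (Paterson S) :=
  {γ | ∃ χ h, χ ∈ U ∧ γ = germ g χ h}

/-- The topology with basis the sets `D(g, U)`, where `U` is an open subset of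
`{χ | χ(g⁻¹ g) = 1}`. -/
instance : TopologicalSpace (Paterson S) :=
  TopologicalSpace.generateFrom
    {W | ∃ g U, IsOpen U ∧ U ⊆ {χ : semiChars S | χ.1 (dom g) = true} ∧ W = basicSet g U}

theorem isOpen_germ_preimage {W : Set (Paterson S)} (hW : IsOpen W) (g : LeftHull S) :
    IsOpen {χ : semiChars S | ∃ h, germ g χ h ∈ W} := by
  induction hW with
  | basic W hW =>
    obtain ⟨k, U, hU, -, rfl⟩ := hW
    have : {χ : semiChars S | ∃ h, germ g χ h ∈ basicSet k U} =
        ⋃ p ∈ {p : Idem S | g * p.1 = k * p.1}, (U ∩ {χ : semiChars S | χ.1 (dom g) = true} ∩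
          {χ : semiChars S | χ.1 (dom k) = true}) ∩ {χ : semiChars S | χ.1 p = true} := by
      ext χ
      simp only [Set.mem_ofPred_eq, Set.mem_iUnion, Set.mem_inter_iff, exists_prop, basicSet]
      constructor
      · rintro ⟨h, χ', h', hχ', e⟩
        obtain ⟨rfl, p, hp, hχp⟩ := germ_eq_iff.1 e
        exact ⟨p, hp, ⟨⟨hχ', h⟩, h'⟩, hχp⟩
      · rintro ⟨p, hp, ⟨⟨hχ, h⟩, h'⟩, hχp⟩
        exact ⟨h, χ, h', hχ, germ_eq_iff.2 ⟨rfl, p, hp, hχp⟩⟩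
    rw [this]
    exact isOpen_biUnion fun p _ => ((hU.inter (isClopen_eval _).isOpen).inter
      (isClopen_eval _).isOpen).inter (isClopen_eval _).isOpen
  | univ => simpa using (isClopen_eval (dom g)).isOpen
  | inter W W' _ _ h h' =>
    have : {χ : semiChars S | ∃ h, germ g χ h ∈ W ∩ W'} =
        {χ : semiChars S | ∃ h, germ g χ h ∈ W} ∩ {χ : semiChars S | ∃ h, germ g χ h ∈ W'} := by
      ext χ
      exact ⟨fun ⟨h, h1, h2⟩ => ⟨⟨h, h1⟩, ⟨h, h2⟩⟩, fun ⟨⟨h, h1⟩, ⟨_, h2⟩⟩ => ⟨h, h1, h2⟩⟩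
    rw [this]
    exact IsOpen.inter h h'
  | sUnion Ws _ ih =>
    have : {χ : semiChars S | ∃ h, germ g χ h ∈ ⋃₀ Ws} =
        ⋃ W ∈ Ws, {χ : semiChars S | ∃ h, germ g χ h ∈ W} := by
      ext χ
      simp only [Set.mem_ofPred_eq, Set.mem_sUnion, Set.mem_iUnion, exists_prop]
      exact ⟨fun ⟨h, W, hW, hm⟩ => ⟨W, hW, h, hm⟩, fun ⟨W, hW, h, hm⟩ => ⟨h, W, hW, hm⟩⟩
    rw [this]
    exact isOpen_biUnion ih

end Paterson

open Paterson

variable (S) in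
/-- The reduction `𝒢_P(S)` of the Paterson groupoid to the closed invariant set `Ω(S)`, with
the relative topology. -/
def GP : Type u := {γ : Paterson S // src γ ∈ omega S}

namespace GP

instance : TopologicalSpace (GP S) := inferInstanceAs (TopologicalSpace (Subtype _))

theorem rng_mem (γ : GP S) : Paterson.rng γ.1 ∈ omega S := by
  obtain ⟨⟨g, χ, h, e⟩, hγ⟩ := And.intro (exists_germ γ.1) γ.2
  rw [e] at hγ ⊢
  exact act_mem_omega h hγ

/-- The source map, with values in the unit space `Ω(S)`. -/
def src (γ : GP S) : omega S := ⟨Paterson.src γ.1, γ.2⟩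

/-- The range map, with values in the unit space `Ω(S)`. -/
noncomputable def rng (γ : GP S) : omega S := ⟨Paterson.rng γ.1, γ.rng_mem⟩

/-- The inverse, restricted to the reduction. -/
noncomputable def inv (γ : GP S) : GP S :=
  ⟨Paterson.inv γ.1, (Paterson.src_inv γ.1).symm ▸ γ.rng_mem⟩

/-- The product of composable elements, restricted to the reduction. -/
noncomputable def mul (a b : GP S) (h : src a = rng b) : GP S :=
  ⟨Paterson.mul a.1 b.1 (congrArg Subtype.val h), b.2⟩

/-- The class `[g, χ]` with `χ ∈ Ω(S)`. -/
def germ (g : LeftHull S) (χ : omega S) (h : χ.1.1 (dom g) = true) : GP S :=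
  ⟨Paterson.germ g χ.1 h, χ.2⟩

/-- `D(g, Ω(S))`: the set of all germs `[g, χ]` with `χ ∈ Ω(S)`. -/
def bisection (g : LeftHull S) : Set (GP S) := {γ | ∃ χ h, γ = germ g χ h}

theorem src_inv (γ : GP S) : src (inv γ) = rng γ := Subtype.ext (Paterson.src_inv γ.1)

theorem rng_inv (γ : GP S) : rng (inv γ) = src γ := Subtype.ext (Paterson.rng_inv γ.1)

theorem inv_inv (γ : GP S) : inv (inv γ) = γ := Subtype.ext (Paterson.inv_inv γ.1)

/-- Convolution of functions on the groupoid: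
`(f₁ * f₂)(γ) = ∑ f₁(η) f₂(η⁻¹ γ)`, the sum being over all `η` with `r(η) = r(γ)`. -/
noncomputable def conv (f₁ f₂ : GP S → ℂ) (γ : GP S) : ℂ :=
  ∑ᶠ η : {η : GP S // rng η = rng γ}, f₁ η.1 * f₂ (mul (inv η.1) γ ((src_inv η.1).trans η.2))

/-- The involution `f*(γ) = conj f(γ⁻¹)`. -/
noncomputable def invol (f : GP S → ℂ) (γ : GP S) : ℂ := star (f (inv γ))

end GP

/-- The space `C_c(X)` of a not necessarily Hausdorff space `X`: the linear span, in the space of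
all functions on `X`, of the continuous compactly supported functions on open Hausdorff subsets
`V` of `X`, extended by zero. -/
def Cc (X : Type*) [TopologicalSpace X] : Submodule ℂ (X → ℂ) :=
  Submodule.span ℂ {f | ∃ V : Set X, IsOpen V ∧ T2Space V ∧ ContinuousOn f V ∧
    ∃ K ⊆ V, IsCompact K ∧ ∀ x ∉ K, f x = 0}

namespace GP

theorem exists_germ (γ : GP S) : ∃ g χ h, γ = germ g χ h := by
  obtain ⟨g, χ, h, e⟩ := Paterson.exists_germ γ.1
  exact ⟨g, ⟨χ, by have := γ.2; rw [e] at this; exact this⟩, h, Subtype.ext e⟩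

theorem germ_eq_iff {g g' : LeftHull S} {χ χ' : omega S} {h : χ.1.1 (dom g) = true}
    {h' : χ'.1.1 (dom g') = true} : germ g χ h = germ g' χ' h' ↔
      χ = χ' ∧ ∃ p : Idem S, g * p.1 = g' * p.1 ∧ χ.1.1 p = true :=
  Subtype.ext_iff.trans (Paterson.germ_eq_iff.trans (and_congr_left fun _ => Subtype.ext_iff.symm))

theorem src_germ (g : LeftHull S) (χ : omega S) (h) : src (germ g χ h) = χ := rfl

/-- The action of `g` on `Ω(S)`. -/
noncomputable def actΩ (g : LeftHull S) (χ : omega S) (h : χ.1.1 (dom g) = true) : omega S :=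
  ⟨act g χ.1 h, act_mem_omega h χ.2⟩

theorem rng_germ (g : LeftHull S) (χ : omega S) (h) : rng (germ g χ h) = actΩ g χ h := rfl

theorem actΩ_injective {g : LeftHull S} {χ χ' : omega S} {h h'} (e : actΩ g χ h = actΩ g χ' h') :
    χ = χ' := by
  apply Subtype.ext
  have e' : act g χ.1 h = act g χ'.1 h' := congrArg Subtype.val e
  rw [← act_inv_act h, ← act_inv_act h']
  congr 1

theorem mul_germ {g h : LeftHull S} {χ ψ : omega S} (hg : χ.1.1 (dom g) = true)
    (hh : ψ.1.1 (dom h) = true) (e : χ = actΩ h ψ hh) (hgh : ψ.1.1 (dom (g * h)) = true) :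
    mul (germ g χ hg) (germ h ψ hh) e = germ (g * h) ψ hgh :=
  Subtype.ext (Paterson.mul_germ hg hh (congrArg Subtype.val e) hgh)

theorem inv_germ (g : LeftHull S) (χ : omega S) (h) :
    inv (germ g χ h) = germ g⁻¹ (actΩ g χ h) (dom_inv_act h) := rfl

theorem mem_bisection_iff {g : LeftHull S} {γ : GP S} :
    γ ∈ bisection g ↔ ∃ h, γ = germ g (src γ) h :=
  ⟨fun ⟨_, h, e⟩ => by subst e; exact ⟨h, rfl⟩, fun ⟨h, e⟩ => ⟨_, h, e⟩⟩

theorem germ_mem_bisection (g : LeftHull S) (χ : omega S) (h) : germ g χ h ∈ bisection g :=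
  ⟨χ, h, rfl⟩

theorem germ_inv_mul {g k : LeftHull S} {χ : omega S} (h : χ.1.1 (dom (g⁻¹ * k)) = true)
    (h1 : χ.1.1 (dom (g * (g⁻¹ * k))) = true) (h2 : χ.1.1 (dom k) = true) :
    germ (g * (g⁻¹ * k)) χ h1 = germ k χ h2 := by
  refine germ_eq_iff.2 ⟨rfl, dom (g⁻¹ * k), ?_, h⟩
  ext x y
  rw [mem_mul, mem_mul]
  refine exists_congr fun z => and_congr_right fun hz => ?_
  obtain rfl := (dom (g⁻¹ * k)).eq_of_mem hz
  obtain ⟨w, hw⟩ := mem_dom.1 hz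
  obtain ⟨v, hv, hw'⟩ := mem_mul.1 hw
  rw [mem_mul]
  constructor
  · rintro ⟨w', hw', hy⟩
    obtain rfl := val_unique hw hw'
    obtain ⟨v', hv', hw''⟩ := mem_mul.1 hw'
    obtain rfl := val_unique (mem_inv.1 hw'') hy
    exact hv'
  · intro hy
    obtain rfl := val_unique hv hy
    exact ⟨w, hw, mem_inv.1 hw'⟩


theorem dom_inv_mul {g h : LeftHull S} {χ : semiChars S} (H : χ.1 (dom (g * h)) = true) :
    χ.1 (dom (g⁻¹ * (g * h))) = true := by
  have e : dom (g⁻¹ * (g * h)) = dom (g * h) := by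
    apply Idem.ext'
    intro x
    rw [mem_dom, mem_dom]
    constructor
    · rintro ⟨y, hy⟩
      obtain ⟨z, hz, _⟩ := mem_mul.1 hy
      exact ⟨z, hz⟩
    · rintro ⟨z, hz⟩
      obtain ⟨w, hw, hz'⟩ := mem_mul.1 hz
      exact ⟨w, mem_mul.2 ⟨z, hz, mem_inv.2 hz'⟩⟩
  rw [e, H]

open Classical in
/-- The function supported on `D(g, Ω(S))` with `[g, χ] ↦ φ(χ)`. -/
noncomputable def delta (g : LeftHull S) (φ : C(omega S, ℂ)) (γ : GP S) : ℂ :=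
  if γ ∈ bisection g then φ (src γ) else 0

theorem delta_germ (g : LeftHull S) (φ : C(omega S, ℂ)) (χ : omega S) (h) :
    delta g φ (germ g χ h) = φ χ := by
  rw [delta, if_pos (germ_mem_bisection g χ h), src_germ]

theorem delta_of_notMem {g : LeftHull S} (φ : C(omega S, ℂ)) {γ : GP S} (h : γ ∉ bisection g) :
    delta g φ γ = 0 := if_neg h

theorem mem_of_delta_ne {g : LeftHull S} {φ : C(omega S, ℂ)} {γ : GP S} (h : delta g φ γ ≠ 0) :
    γ ∈ bisection g := by
  by_contra h'
  exact h (delta_of_notMem φ h')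

theorem delta_congr {g : LeftHull S} {φ ψ : C(omega S, ℂ)}
    (H : ∀ χ : omega S, χ.1.1 (dom g) = true → φ χ = ψ χ) : delta g φ = delta g ψ := by
  funext γ
  by_cases h : γ ∈ bisection g
  · obtain ⟨χ, hχ, rfl⟩ := h
    rw [delta_germ, delta_germ, H χ hχ]
  · rw [delta_of_notMem φ h, delta_of_notMem ψ h]

theorem isClopen_domΩ (p : Idem S) : IsClopen {χ : omega S | χ.1.1 p = true} :=
  (isClopen_eval p).preimage continuous_subtype_val

theorem continuous_actΩ (g : LeftHull S) :
    Continuous fun χ : {χ : omega S | χ.1.1 (dom g) = true} => actΩ g χ.1 χ.2 := by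
  refine Continuous.subtype_mk ?_ _
  exact (continuous_act g).comp
    ((continuous_subtype_val.comp continuous_subtype_val).subtype_mk fun χ => χ.2)

open Classical in
/-- Extension by zero of a continuous function from a clopen set. -/
theorem continuous_extend {X : Type*} [TopologicalSpace X] {P : X → Prop}
    (hP : IsClopen {x | P x}) (F : ∀ x, P x → ℂ)
    (hF : Continuous fun x : {x | P x} => F x.1 x.2) :
    Continuous fun x => if h : P x then F x h else 0 := by
  rw [continuous_iff_continuousAt]
  intro x
  by_cases hx : P x
  · have h1 : ContinuousOn (fun x => if h : P x then F x h else 0) {x | P x} := by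
      rw [continuousOn_iff_continuous_domRestrict]
      convert hF using 2 with y
      exact dif_pos y.2
    exact h1.continuousAt (hP.isOpen.mem_nhds hx)
  · have : (fun _ => (0 : ℂ)) =ᶠ[nhds x] fun x => if h : P x then F x h else 0 := by
      filter_upwards [hP.compl.isOpen.mem_nhds hx] with y hy
      have hy' : ¬ P y := hy
      simp only [hy', dite_false]
    exact continuousAt_const.congr this

open Classical in
/-- The function `χ ↦ φ(χ(g⁻¹ · g))` on `{χ | χ(g⁻¹ g) = 1}`, extended by zero. -/
noncomputable def pull (g : LeftHull S) (φ : C(omega S, ℂ)) : C(omega S, ℂ) where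
  toFun χ := if h : χ.1.1 (dom g) = true then φ (actΩ g χ h) else 0
  continuous_toFun := by
    convert! continuous_extend (isClopen_domΩ (dom g)) (fun χ h => φ (actΩ g χ h))
      (φ.continuous.comp (continuous_actΩ g))

theorem pull_pos {g : LeftHull S} (φ : C(omega S, ℂ)) {χ : omega S} (h : χ.1.1 (dom g) = true) :
    pull g φ χ = φ (actΩ g χ h) := dif_pos h

theorem pull_neg {g : LeftHull S} (φ : C(omega S, ℂ)) {χ : omega S} (h : ¬ χ.1.1 (dom g) = true) :
    pull g φ χ = 0 := dif_neg h

theorem pull_mul (g : LeftHull S) (φ ψ : C(omega S, ℂ)) :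
    pull g (φ * ψ) = pull g φ * pull g ψ := by
  ext χ
  by_cases h : χ.1.1 (dom g) = true
  · simp [pull_pos _ h]
  · simp [pull_neg _ h]

theorem pull_star (g : LeftHull S) (φ : C(omega S, ℂ)) : pull g (star φ) = star (pull g φ) := by
  ext χ
  by_cases h : χ.1.1 (dom g) = true
  · simp [pull_pos _ h]
  · simp [pull_neg _ h]

theorem pull_pull (g h : LeftHull S) (φ : C(omega S, ℂ)) :
    pull h (pull g φ) = pull (g * h) φ := by
  ext χ
  by_cases H : χ.1.1 (dom (g * h)) = true
  · obtain ⟨hh, hg⟩ := (dom_mul_iff _ _ _).1 H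
    rw [pull_pos _ H, pull_pos _ hh, pull_pos (χ := actΩ h χ hh) _ hg]
    congr 1
    exact Subtype.ext (act_act hh hg H)
  · rw [pull_neg _ H]
    by_cases hh : χ.1.1 (dom h) = true
    · rw [pull_pos _ hh, pull_neg]
      intro hg
      exact H ((dom_mul_iff _ _ _).2 ⟨hh, hg⟩)
    · rw [pull_neg _ hh]

theorem pull_idem (p : Idem S) (φ : C(omega S, ℂ)) {χ : omega S} (h : χ.1.1 p = true) :
    pull p.1 φ χ = φ χ := by
  have h' : χ.1.1 (dom p.1) = true := by rw [dom_idem, h]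
  rw [pull_pos _ h']
  congr 1
  exact Subtype.ext (act_idem p χ.1 h')

theorem inv_mul_germ {g k : LeftHull S} {χ' χ : omega S} (h' : χ'.1.1 (dom g) = true)
    (hk : χ.1.1 (dom k) = true) (e) (hgk : χ.1.1 (dom (g⁻¹ * k)) = true) :
    mul (inv (germ g χ' h')) (germ k χ hk) e = germ (g⁻¹ * k) χ hgk :=
  Subtype.ext (Paterson.mul_germ (dom_inv_act h') hk (congrArg Subtype.val e) hgk)

theorem conv_delta (g h : LeftHull S) (φ ψ : C(omega S, ℂ)) :
    conv (delta g φ) (delta h ψ) = delta (g * h) (pull h φ * ψ) := by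
  funext γ
  by_cases hγ : γ ∈ bisection (g * h)
  · obtain ⟨χ, H, rfl⟩ := hγ
    obtain ⟨hh, hg⟩ := (dom_mul_iff _ _ _).1 H
    replace hg : (actΩ h χ hh).1.1 (dom g) = true := hg
    have er : rng (germ g (actΩ h χ hh) hg) = rng (germ (g * h) χ H) :=
      Subtype.ext (act_act hh hg H)
    have e1 : mul (inv (germ g (actΩ h χ hh) hg)) (germ (g * h) χ H)
        ((src_inv _).trans er) = germ h χ hh := by
      rw [inv_mul_germ hg H _ (dom_inv_mul H)]
      exact germ_inv_mul (g := g⁻¹) H (dom_inv_mul H) hh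
    rw [conv, finsum_eq_single _ (⟨germ g (actΩ h χ hh) hg, er⟩ : {η // rng η = _})]
    · simp only [e1]
      rw [delta_germ, delta_germ, delta_germ, ContinuousMap.mul_apply, pull_pos _ hh]
    · rintro ⟨η, hη⟩ hne
      rw [delta_of_notMem, zero_mul]
      rintro ⟨χ', h', rfl⟩
      apply hne
      have e2 : actΩ g χ' h' = actΩ g (actΩ h χ hh) hg := hη.trans er.symm
      obtain rfl := actΩ_injective e2
      rfl
  · rw [delta_of_notMem _ hγ, conv]
    apply finsum_eq_zero_of_forall_eq_zero
    rintro ⟨η, hη⟩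
    by_contra hne
    obtain ⟨χ', h', rfl⟩ := mem_of_delta_ne (left_ne_zero_of_mul hne)
    obtain ⟨χ'', h'', e⟩ := mem_of_delta_ne (right_ne_zero_of_mul hne)
    obtain ⟨k, χ, hk, rfl⟩ := exists_germ γ
    have hη' : actΩ g χ' h' = actΩ k χ hk := hη
    have hgk : χ.1.1 (dom (g⁻¹ * k)) = true := by
      refine (dom_mul_iff _ _ _).2 ⟨hk, ?_⟩
      have : act k χ.1 hk = act g χ'.1 h' := (congrArg Subtype.val hη').symm
      rw [this]
      exact dom_inv_act h'
    have e2 : germ (g⁻¹ * k) χ hgk = germ h χ'' h'' :=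
      (inv_mul_germ h' hk _ hgk).symm.trans e
    obtain ⟨rfl, p, hp, hχp⟩ := germ_eq_iff.1 e2
    have hgk2 : χ.1.1 (dom (g * (g⁻¹ * k))) = true := dom_inv_mul (g := g⁻¹) hgk
    have e3 := germ_inv_mul hgk hgk2 hk
    have hgh : χ.1.1 (dom (g * h)) = true := by
      have := dom_mul_congr (g := g * (g⁻¹ * k)) (h := g * h) (p := p)
        (by rw [mul_assoc, hp, mul_assoc])
      have := congrArg χ.1.1 this
      rw [semiChars.map_mul, semiChars.map_mul, hχp, hgk2] at this
      simpa using this.symm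
    apply hγ
    refine ⟨χ, hgh, e3.symm.trans (germ_eq_iff.2 ⟨rfl, p, ?_, hχp⟩)⟩
    rw [mul_assoc, hp, mul_assoc]

theorem invol_delta (g : LeftHull S) (φ : C(omega S, ℂ)) :
    invol (delta g φ) = delta g⁻¹ (pull g⁻¹ (star φ)) := by
  funext γ
  by_cases h : γ ∈ bisection g⁻¹
  · obtain ⟨χ, hχ, rfl⟩ := h
    rw [invol, inv_germ, delta_germ, pull_pos _ hχ]
    congr 1
    exact delta_germ g φ _ _
  · rw [delta_of_notMem _ h, invol, delta_of_notMem, star_zero]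
    rintro ⟨χ, hχ, e⟩
    apply h
    rw [← inv_inv γ, e]
    exact germ_mem_bisection g⁻¹ (actΩ g χ hχ) (dom_inv_act hχ)

/-! Bilinearity of the convolution on functions with finite supports in the range fibres. -/

/-- Functions whose restriction to every range fibre has finite support. -/
def FiberFinite (f : GP S → ℂ) : Prop := ∀ x : omega S, {η : GP S | rng η = x ∧ f η ≠ 0}.Finite

theorem fiberFinite_delta (g : LeftHull S) (φ : C(omega S, ℂ)) : FiberFinite (delta g φ) := by
  intro x
  apply Set.Subsingleton.finite
  rintro η ⟨hη, hne⟩ η' ⟨hη', hne'⟩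
  obtain ⟨χ, h, rfl⟩ := mem_of_delta_ne (S := S) (g := g) (φ := φ) hne
  obtain ⟨χ', h', rfl⟩ := mem_of_delta_ne (S := S) (g := g) (φ := φ) hne'
  have : actΩ g χ h = actΩ g χ' h' := hη.trans hη'.symm
  obtain rfl := actΩ_injective this
  rfl

variable (S) in
/-- The submodule of functions with finite supports in the range fibres. -/
def fiberFinite : Submodule ℂ (GP S → ℂ) where
  carrier := {f | FiberFinite f}
  zero_mem' x := by simp
  add_mem' {f₁ f₂} h₁ h₂ x := by
    refine ((h₁ x).union (h₂ x)).subset ?_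
    rintro η ⟨hη, hne⟩
    by_cases h : f₁ η = 0
    · refine Or.inr ⟨hη, fun h' => hne ?_⟩
      rw [Pi.add_apply, h, h', add_zero]
    · exact Or.inl ⟨hη, h⟩
  smul_mem' c f h x := by
    refine (h x).subset ?_
    rintro η ⟨hη, hne⟩
    exact ⟨hη, fun h' => hne (by rw [Pi.smul_apply, h', smul_zero])⟩

theorem FiberFinite.hasFiniteSupport {f₁ : GP S → ℂ} (h₁ : FiberFinite f₁) (f₂ : GP S → ℂ)
    (γ : GP S) : (Function.support fun η : {η : GP S // rng η = rng γ} =>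
      f₁ η.1 * f₂ (mul (inv η.1) γ ((src_inv η.1).trans η.2))).Finite := by
  refine Set.Finite.subset (Set.Finite.preimage Subtype.val_injective.injOn (h₁ (rng γ))) ?_
  rintro η hη
  exact ⟨η.2, left_ne_zero_of_mul hη⟩

theorem conv_add_left {f₁ f₁' : GP S → ℂ} (h : FiberFinite f₁) (h' : FiberFinite f₁')
    (f₂ : GP S → ℂ) : conv (f₁ + f₁') f₂ = conv f₁ f₂ + conv f₁' f₂ := by
  funext γ
  simp only [conv, Pi.add_apply, add_mul]
  exact finsum_add_distrib (h.hasFiniteSupport f₂ γ) (h'.hasFiniteSupport f₂ γ)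

theorem conv_add_right {f₁ : GP S → ℂ} (h : FiberFinite f₁) (f₂ f₂' : GP S → ℂ) :
    conv f₁ (f₂ + f₂') = conv f₁ f₂ + conv f₁ f₂' := by
  funext γ
  simp only [conv, Pi.add_apply, mul_add]
  exact finsum_add_distrib (h.hasFiniteSupport f₂ γ) (h.hasFiniteSupport f₂' γ)

theorem conv_smul_left (c : ℂ) (f₁ f₂ : GP S → ℂ) : conv (c • f₁) f₂ = c • conv f₁ f₂ := by
  funext γ
  simp only [conv, Pi.smul_apply, smul_eq_mul, mul_assoc]
  exact (smul_finsum c _).symm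

theorem conv_smul_right (c : ℂ) (f₁ f₂ : GP S → ℂ) : conv f₁ (c • f₂) = c • conv f₁ f₂ := by
  funext γ
  simp only [conv, Pi.smul_apply, smul_eq_mul, mul_left_comm _ c]
  exact (smul_finsum c _).symm

theorem conv_zero_left (f : GP S → ℂ) : conv 0 f = 0 := by
  have := conv_smul_left 0 (0 : GP S → ℂ) f
  simpa using this

theorem conv_zero_right (f : GP S → ℂ) : conv f 0 = 0 := by
  have := conv_smul_right 0 f (0 : GP S → ℂ)
  simpa using this

variable (S) in
/-- The functions `delta g φ`. -/
def deltas : Set (GP S → ℂ) := {f | ∃ g φ, f = delta g φ}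

theorem fiberFinite_of_mem {f : GP S → ℂ} (h : f ∈ Submodule.span ℂ (deltas S)) :
    FiberFinite f := by
  have : Submodule.span ℂ (deltas S) ≤ fiberFinite S := by
    rw [Submodule.span_le]
    rintro _ ⟨g, φ, rfl⟩
    exact fiberFinite_delta g φ
  exact this h

theorem conv_mem {f₁ f₂ : GP S → ℂ} (h₁ : f₁ ∈ Submodule.span ℂ (deltas S))
    (h₂ : f₂ ∈ Submodule.span ℂ (deltas S)) : conv f₁ f₂ ∈ Submodule.span ℂ (deltas S) := by
  induction h₁ using Submodule.span_induction with
  | mem f hf =>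
    obtain ⟨g, φ, rfl⟩ := hf
    induction h₂ using Submodule.span_induction with
    | mem f hf =>
      obtain ⟨h, ψ, rfl⟩ := hf
      rw [conv_delta]
      exact Submodule.subset_span ⟨_, _, rfl⟩
    | zero => rw [conv_zero_right]; exact Submodule.zero_mem _
    | add f f' _ _ h h' =>
      rw [conv_add_right (fiberFinite_delta g φ)]; exact Submodule.add_mem _ h h'
    | smul c f _ h => rw [conv_smul_right]; exact Submodule.smul_mem _ c h
  | zero => rw [conv_zero_left]; exact Submodule.zero_mem _
  | add f f' hf hf' h h' =>
    rw [conv_add_left (fiberFinite_of_mem hf) (fiberFinite_of_mem hf')]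
    exact Submodule.add_mem _ h h'
  | smul c f _ h => rw [conv_smul_left]; exact Submodule.smul_mem _ c h

theorem invol_add (f f' : GP S → ℂ) : invol (f + f') = invol f + invol f' := by
  funext γ; simp [invol]

theorem invol_smul (c : ℂ) (f : GP S → ℂ) : invol (c • f) = star c • invol f := by
  funext γ; simp [invol]

theorem invol_zero : invol (0 : GP S → ℂ) = 0 := by
  funext γ; simp [invol]

theorem invol_invol (f : GP S → ℂ) : invol (invol f) = f := by
  funext γ; simp [invol, inv_inv]

theorem invol_mem {f : GP S → ℂ} (h : f ∈ Submodule.span ℂ (deltas S)) :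
    invol f ∈ Submodule.span ℂ (deltas S) := by
  induction h using Submodule.span_induction with
  | mem f hf =>
    obtain ⟨g, φ, rfl⟩ := hf
    rw [invol_delta]
    exact Submodule.subset_span ⟨_, _, rfl⟩
  | zero => rw [invol_zero]; exact Submodule.zero_mem _
  | add f f' _ _ h h' => rw [invol_add]; exact Submodule.add_mem _ h h'
  | smul c f _ h => rw [invol_smul]; exact Submodule.smul_mem _ _ h

theorem conv_assoc {f₁ f₂ f₃ : GP S → ℂ} (h₁ : f₁ ∈ Submodule.span ℂ (deltas S))
    (h₂ : f₂ ∈ Submodule.span ℂ (deltas S)) (h₃ : f₃ ∈ Submodule.span ℂ (deltas S)) :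
    conv (conv f₁ f₂) f₃ = conv f₁ (conv f₂ f₃) := by
  induction h₁ using Submodule.span_induction with
  | mem f hf =>
    obtain ⟨g, φ, rfl⟩ := hf
    have hg := fiberFinite_delta g φ
    have hg' : delta g φ ∈ Submodule.span ℂ (deltas S) := Submodule.subset_span ⟨_, _, rfl⟩
    induction h₂ using Submodule.span_induction with
    | mem f hf =>
      obtain ⟨h, ψ, rfl⟩ := hf
      have hh := fiberFinite_delta h ψ
      have hgh : FiberFinite (conv (delta g φ) (delta h ψ)) := by
        rw [conv_delta]; exact fiberFinite_delta _ _
      induction h₃ using Submodule.span_induction with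
      | mem f hf =>
        obtain ⟨k, ω, rfl⟩ := hf
        rw [conv_delta, conv_delta, conv_delta, conv_delta, pull_mul, pull_pull, mul_assoc,
          mul_assoc]
      | zero => simp only [conv_zero_right]
      | add f f' _ _ h h' =>
        rw [conv_add_right hgh, conv_add_right hh, conv_add_right hg, h, h']
      | smul c f _ h => rw [conv_smul_right, conv_smul_right, conv_smul_right, h]
    | zero => simp only [conv_zero_right, conv_zero_left]
    | add f f' hf hf' h h' =>
      rw [conv_add_right hg, conv_add_left (fiberFinite_of_mem hf) (fiberFinite_of_mem hf'),
        conv_add_right hg, conv_add_left (fiberFinite_of_mem (conv_mem hg' hf))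
        (fiberFinite_of_mem (conv_mem hg' hf')), h, h']
    | smul c f _ h =>
      rw [conv_smul_right, conv_smul_left, conv_smul_left, conv_smul_right, h]
  | zero => simp only [conv_zero_left]
  | add f f' hf hf' h h' =>
    rw [conv_add_left (fiberFinite_of_mem hf) (fiberFinite_of_mem hf'),
      conv_add_left (fiberFinite_of_mem (conv_mem hf h₂)) (fiberFinite_of_mem (conv_mem hf' h₂)),
      conv_add_left (fiberFinite_of_mem hf) (fiberFinite_of_mem hf'), h, h']
  | smul c f _ h => rw [conv_smul_left, conv_smul_left, conv_smul_left, h]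

theorem invol_conv {f₁ f₂ : GP S → ℂ} (h₁ : f₁ ∈ Submodule.span ℂ (deltas S))
    (h₂ : f₂ ∈ Submodule.span ℂ (deltas S)) :
    invol (conv f₁ f₂) = conv (invol f₂) (invol f₁) := by
  induction h₁ using Submodule.span_induction with
  | mem f hf =>
    obtain ⟨g, φ, rfl⟩ := hf
    induction h₂ using Submodule.span_induction with
    | mem f hf =>
      obtain ⟨h, ψ, rfl⟩ := hf
      rw [conv_delta, invol_delta, invol_delta, invol_delta, conv_delta, mul_inv']
      congr 1
      rw [star_mul, pull_mul, pull_pull, ← pull_star, pull_pull]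
      ext χ
      rw [ContinuousMap.mul_apply, ContinuousMap.mul_apply]
      by_cases H : χ.1.1 (dom (h⁻¹ * g⁻¹)) = true
      · congr 1
        obtain ⟨hg, hh⟩ := (dom_mul_iff _ _ _).1 H
        rw [← mul_assoc, ← pull_pull, pull_pos _ hg, pull_pos _ hg]
        exact pull_idem (dom h⁻¹) _ hh
      · rw [pull_neg _ H, zero_mul, zero_mul]
    | zero => simp only [conv_zero_right, invol_zero, conv_zero_left]
    | add f f' hf hf' h h' =>
      rw [conv_add_right (fiberFinite_delta g φ), invol_add, invol_add, conv_add_left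
        (fiberFinite_of_mem (invol_mem hf)) (fiberFinite_of_mem (invol_mem hf')), h, h']
    | smul c f _ h => rw [conv_smul_right, invol_smul, invol_smul, conv_smul_left, h]
  | zero => simp only [conv_zero_left, invol_zero, conv_zero_right]
  | add f f' hf hf' h h' =>
    rw [conv_add_left (fiberFinite_of_mem hf) (fiberFinite_of_mem hf'), invol_add, invol_add,
      conv_add_right (fiberFinite_of_mem (invol_mem h₂)), h, h']
  | smul c f _ h => rw [conv_smul_left, invol_smul, invol_smul, conv_smul_right, h]

/-! The space `C_c(𝒢_P(S))` is spanned by the functions `delta g φ`. -/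

theorem isOpen_germ_preimage {W : Set (GP S)} (hW : IsOpen W) (g : LeftHull S) :
    IsOpen {χ : omega S | ∃ h, germ g χ h ∈ W} := by
  obtain ⟨W', hW', rfl⟩ := isOpen_induced_iff.1 hW
  exact (Paterson.isOpen_germ_preimage hW' g).preimage continuous_subtype_val

/-- `D(g, U)` for `U ⊆ Ω(S)`. -/
def germSet (g : LeftHull S) (U : Set (omega S)) : Set (GP S) :=
  {γ | ∃ χ h, χ ∈ U ∧ γ = germ g χ h}

theorem isOpen_germSet (g : LeftHull S) {U : Set (omega S)} (hU : IsOpen U) :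
    IsOpen (germSet g U) := by
  obtain ⟨O, hO, rfl⟩ := isOpen_induced_iff.1 hU
  refine isOpen_induced_iff.2 ⟨basicSet g (O ∩ {χ : semiChars S | χ.1 (dom g) = true}),
    TopologicalSpace.isOpen_generateFrom_of_mem ⟨g, _, hO.inter (isClopen_eval _).isOpen,
      Set.inter_subset_right, rfl⟩, ?_⟩
  ext γ
  constructor
  · rintro ⟨χ, h, hχ, e⟩
    have hmem : χ ∈ omega S := by have := γ.2; rw [e] at this; exact this
    exact ⟨⟨χ, hmem⟩, h, hχ.1, Subtype.ext e⟩
  · rintro ⟨χ, h, hχ, rfl⟩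
    exact ⟨χ.1, h, ⟨hχ, h⟩, rfl⟩

theorem continuous_src : Continuous (src : GP S → omega S) := by
  refine ⟨fun U hU => ?_⟩
  have : src ⁻¹' U = ⋃ g, germSet (S := S) g U := by
    ext γ
    simp only [Set.mem_preimage, Set.mem_iUnion]
    constructor
    · intro h
      obtain ⟨g, χ, hg, rfl⟩ := exists_germ γ
      exact ⟨g, χ, hg, h, rfl⟩
    · rintro ⟨g, χ, hg, h, rfl⟩
      exact h
  rw [this]
  exact isOpen_iUnion fun g => isOpen_germSet g hU

theorem continuous_germ (g : LeftHull S) :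
    Continuous fun χ : {χ : omega S | χ.1.1 (dom g) = true} => germ g χ.1 χ.2 := by
  refine ⟨fun W hW => ?_⟩
  refine isOpen_induced_iff.2 ⟨_, isOpen_germ_preimage hW g, ?_⟩
  ext χ
  exact ⟨fun ⟨_, h⟩ => h, fun h => ⟨χ.2, h⟩⟩

instance : CompactSpace (semiChars S) := isCompact_iff_compactSpace.1 semiChars.isClosed.isCompact

instance : CompactSpace (omega S) :=
  isCompact_iff_compactSpace.1 (isClosed_closure (s := Set.range point)).isCompact

theorem isCompact_germSet (g : LeftHull S) {U : Set (omega S)} (hU : IsClosed U) :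
    IsCompact (germSet g U) := by
  have hc : IsCompact {χ : {χ : omega S | χ.1.1 (dom g) = true} | χ.1 ∈ U} := by
    have : CompactSpace {χ : omega S | χ.1.1 (dom g) = true} :=
      isCompact_iff_compactSpace.1 (isClopen_domΩ (dom g)).isClosed.isCompact
    exact (hU.preimage continuous_subtype_val).isCompact
  convert hc.image (continuous_germ g)
  ext γ
  constructor
  · rintro ⟨χ, h, hχ, rfl⟩
    exact ⟨⟨χ, h⟩, hχ, rfl⟩
  · rintro ⟨χ, hχ, rfl⟩
    exact ⟨χ.1, χ.2, hχ, rfl⟩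

theorem bisection_eq (g : LeftHull S) : bisection g = germSet g (Set.univ : Set (omega S)) := by
  ext γ
  exact ⟨fun ⟨χ, h, e⟩ => ⟨χ, h, trivial, e⟩, fun ⟨χ, h, _, e⟩ => ⟨χ, h, e⟩⟩

theorem delta_mem_Cc (g : LeftHull S) (φ : C(omega S, ℂ)) : delta g φ ∈ Cc (GP S) := by
  refine Submodule.subset_span ⟨bisection g, ?_, ?_, ?_, bisection g, subset_rfl, ?_, ?_⟩
  · rw [bisection_eq]; exact isOpen_germSet g isOpen_univ
  · refine T2Space.of_injective_continuous (f := fun γ : bisection g => src γ.1) ?_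
      (continuous_src.comp continuous_subtype_val)
    rintro ⟨γ, χ, h, rfl⟩ ⟨γ', χ', h', rfl⟩ (e : χ = χ')
    subst e
    rfl
  · refine (φ.continuous.comp continuous_src).continuousOn.congr fun γ hγ => ?_
    exact if_pos hγ
  · rw [bisection_eq]; exact isCompact_germSet g isClosed_univ
  · intro γ hγ
    exact delta_of_notMem φ hγ

theorem mem_span_of_cover {V : Set (GP S)} (hVT : T2Space V)
    (t : Finset (LeftHull S × TopologicalSpace.Clopens (omega S)))
    (ht : ∀ x ∈ t, germSet x.1 (x.2 : Set (omega S)) ⊆ V) :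
    ∀ f : GP S → ℂ, ContinuousOn f V →
      (∀ γ, (∀ x ∈ t, γ ∉ germSet x.1 (x.2 : Set (omega S))) → f γ = 0) →
      f ∈ Submodule.span ℂ (deltas S) := by
  classical
  induction t using Finset.induction_on with
  | empty =>
    intro f _ hf
    have : f = 0 := funext fun γ => hf γ (by simp)
    rw [this]
    exact Submodule.zero_mem _
  | insert x t hx ih =>
    intro f hfV hf
    obtain ⟨g, A⟩ := x
    set B : Set (GP S) := germSet g (A : Set (omega S)) with hB
    have hBV : B ⊆ V := ht _ (Finset.mem_insert_self _ _)
    have hBo : IsOpen B := isOpen_germSet g A.isClopen.isOpen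
    have hBc : IsClosed ((Subtype.val : V → GP S) ⁻¹' B) := by
      refine IsCompact.isClosed ?_
      rw [Subtype.isCompact_iff, Subtype.image_preimage_coe, Set.inter_eq_right.2 hBV]
      exact isCompact_germSet g A.isClopen.isClosed
    have hBcl : IsClopen ((Subtype.val : V → GP S) ⁻¹' B) :=
      ⟨hBc, hBo.preimage continuous_subtype_val⟩
    have hsplit : f = B.indicator f + Bᶜ.indicator f := (Set.indicator_self_add_compl B f).symm
    rw [hsplit]
    refine Submodule.add_mem _ ?_ ?_
    · have hP : IsClopen {χ : omega S | χ ∈ (A : Set (omega S)) ∧ χ.1.1 (dom g) = true} :=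
        A.isClopen.inter (isClopen_domΩ (dom g))
      let φ : C(omega S, ℂ) :=
        ⟨fun χ => if h : χ ∈ (A : Set (omega S)) ∧ χ.1.1 (dom g) = true
          then f (germ g χ h.2) else 0, by
          convert! continuous_extend hP (fun χ h => f (germ g χ h.2)) ?_
          have h1 : Continuous fun χ :
              {χ : omega S | χ ∈ (A : Set (omega S)) ∧ χ.1.1 (dom g) = true} =>
              germ g χ.1 χ.2.2 :=
            (continuous_germ g).comp (continuous_subtype_val.subtype_mk fun χ => χ.2.2)
          exact hfV.comp_continuous h1 fun χ => hBV ⟨χ.1, χ.2.2, χ.2.1, rfl⟩⟩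
      have : B.indicator f = delta g φ := by
        funext γ
        by_cases hγ : γ ∈ bisection g
        · obtain ⟨χ, h, rfl⟩ := hγ
          rw [delta_germ]
          by_cases hA : χ ∈ (A : Set (omega S))
          · rw [Set.indicator_of_mem (show germ g χ h ∈ B from ⟨χ, h, hA, rfl⟩)]
            have hc : χ ∈ (A : Set (omega S)) ∧ χ.1.1 (dom g) = true := ⟨hA, h⟩
            change _ = dite _ _ _
            rw [dif_pos hc]
          · rw [Set.indicator_of_notMem]
            · have hc : ¬ (χ ∈ (A : Set (omega S)) ∧ χ.1.1 (dom g) = true) := fun h' => hA h'.1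
              change _ = dite _ _ _
              rw [dif_neg hc]
            · rintro ⟨χ', h', hA', e⟩
              obtain ⟨rfl, -⟩ := germ_eq_iff.1 e
              exact hA hA'
        · rw [delta_of_notMem _ hγ, Set.indicator_of_notMem]
          rintro ⟨χ, h, -, e⟩
          exact hγ ⟨χ, h, e⟩
      rw [this]
      exact Submodule.subset_span ⟨g, φ, rfl⟩
    · refine ih (fun y hy => ht y (Finset.mem_insert_of_mem hy)) _ ?_ ?_
      · rw [continuousOn_iff_continuous_domRestrict] at hfV ⊢
        have := hfV.indicator (s := ((Subtype.val : V → GP S) ⁻¹' Bᶜ)) (by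
          intro a ha
          have : IsClopen ((Subtype.val : V → GP S) ⁻¹' Bᶜ) := hBcl.compl
          rw [this.frontier_eq] at ha
          exact absurd ha (Set.notMem_empty a))
        exact this
      · intro γ hγ
        by_cases h : γ ∈ B
        · exact Set.indicator_of_notMem (s := Bᶜ) (fun h' => h' h) _
        · rw [Set.indicator_of_mem (show γ ∈ Bᶜ from h)]
          refine hf γ fun y hy => ?_
          rcases Finset.mem_insert.1 hy with rfl | hy
          · exact h
          · exact hγ y hy

theorem Cc_eq_span : Cc (GP S) = Submodule.span ℂ (deltas S) := by
  apply le_antisymm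
  · refine Submodule.span_le.2 ?_
    rintro f ⟨V, hV, hVT, hfV, K, hKV, hK, hf⟩
    let ι := {x : LeftHull S × TopologicalSpace.Clopens (omega S) //
      germSet x.1 (x.2 : Set (omega S)) ⊆ V}
    obtain ⟨t, ht⟩ := hK.elim_finite_subcover
      (fun x : ι => germSet x.1.1 (x.1.2 : Set (omega S)))
      (fun x => isOpen_germSet _ x.1.2.isClopen.isOpen) (by
        intro γ hγ
        obtain ⟨g, χ, h, rfl⟩ := exists_germ γ
        have ho := (isOpen_germ_preimage hV g)
        obtain ⟨A, hA, hχA, hAV⟩ := compact_exists_isClopen_in_isOpen ho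
          (show χ ∈ {χ : omega S | ∃ h, germ g χ h ∈ V} from ⟨h, hKV hγ⟩)
        refine Set.mem_iUnion.2 ⟨⟨(g, ⟨A, hA⟩), ?_⟩, χ, h, hχA, rfl⟩
        rintro _ ⟨χ', h', hχ', rfl⟩
        obtain ⟨_, h''⟩ := hAV hχ'
        exact h'')
    classical
    refine mem_span_of_cover hVT (t.image Subtype.val) ?_ f hfV ?_
    · intro x hx
      obtain ⟨y, -, rfl⟩ := Finset.mem_image.1 hx
      exact y.2
    · intro γ hγ
      refine hf γ fun hγK => ?_
      obtain ⟨x, hx, hγx⟩ := Set.mem_iUnion₂.1 (ht hγK)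
      exact hγ x.1 (Finset.mem_image_of_mem _ hx) hγx
  · refine Submodule.span_le.2 ?_
    rintro _ ⟨g, φ, rfl⟩
    exact delta_mem_Cc g φ

end GP

/-! ### The *-algebra `C_c(𝒢_P(S))` and its C*-enveloping algebra -/

open GP

variable (S) in
/-- The *-algebra `C_c(𝒢_P(S))` with convolution and the involution `f*(γ) = conj f(γ⁻¹)`. -/
def CcAlg : Type u := Cc (GP S)

namespace CcAlg

noncomputable instance : AddCommGroup (CcAlg S) := inferInstanceAs (AddCommGroup (Cc (GP S)))

noncomputable instance : Module ℂ (CcAlg S) := inferInstanceAs (Module ℂ (Cc (GP S)))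

theorem mem_span (f : CcAlg S) : f.1 ∈ Submodule.span ℂ (deltas S) := Cc_eq_span (S := S) ▸ f.2

theorem fiberFinite (f : CcAlg S) : FiberFinite f.1 := fiberFinite_of_mem f.mem_span

/-- The function `delta g φ` as an element of the *-algebra. -/
noncomputable def d (g : LeftHull S) (φ : C(omega S, ℂ)) : CcAlg S := ⟨delta g φ, delta_mem_Cc g φ⟩

noncomputable instance : Mul (CcAlg S) where
  mul f₁ f₂ := ⟨conv f₁.1 f₂.1, Cc_eq_span.ge (conv_mem f₁.mem_span f₂.mem_span)⟩

/-- The unit is the indicator function of the unit space `D(e, Ω(S))`. -/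
noncomputable instance : One (CcAlg S) := ⟨d 1 1⟩

noncomputable instance : Star (CcAlg S) where
  star f := ⟨invol f.1, Cc_eq_span.ge (invol_mem f.mem_span)⟩

theorem d_mul (g h : LeftHull S) (φ ψ : C(omega S, ℂ)) :
    d g φ * d h ψ = d (g * h) (pull h φ * ψ) := Subtype.ext (conv_delta g h φ ψ)

theorem d_congr {g : LeftHull S} {φ ψ : C(omega S, ℂ)}
    (H : ∀ χ : omega S, χ.1.1 (dom g) = true → φ χ = ψ χ) : d g φ = d g ψ :=
  Subtype.ext (delta_congr H)

theorem d_star (g : LeftHull S) (φ : C(omega S, ℂ)) : star (d g φ) = d g⁻¹ (pull g⁻¹ (star φ)) :=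
  Subtype.ext (invol_delta g φ)

@[elab_as_elim]
theorem induction {P : CcAlg S → Prop} (f : CcAlg S) (hd : ∀ g φ, P (d g φ)) (h0 : P 0)
    (hadd : ∀ f f', P f → P f' → P (f + f')) (hsmul : ∀ (c : ℂ) f, P f → P (c • f)) : P f := by
  have key : ∀ f (hf : f ∈ Submodule.span ℂ (deltas S)),
      P ⟨f, (Cc_eq_span (S := S)).symm ▸ hf⟩ := by
    intro f hf
    induction hf using Submodule.span_induction with
    | mem f hf => obtain ⟨g, φ, rfl⟩ := hf; exact hd g φ
    | zero => exact h0
    | add f f' _ _ h h' => exact hadd _ _ h h'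
    | smul c f _ h => exact hsmul c _ h
  exact key f.1 f.mem_span

theorem mul_smul' (c : ℂ) (f f' : CcAlg S) : f * (c • f') = c • (f * f') :=
  Subtype.ext (conv_smul_right c f.1 f'.1)

theorem smul_mul' (c : ℂ) (f f' : CcAlg S) : (c • f) * f' = c • (f * f') :=
  Subtype.ext (conv_smul_left c f.1 f'.1)

theorem mul_add' (f f' f'' : CcAlg S) : f * (f' + f'') = f * f' + f * f'' :=
  Subtype.ext (conv_add_right f.fiberFinite f'.1 f''.1)

theorem add_mul' (f f' f'' : CcAlg S) : (f + f') * f'' = f * f'' + f' * f'' :=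
  Subtype.ext (conv_add_left f.fiberFinite f'.fiberFinite f''.1)

theorem zero_mul' (f : CcAlg S) : 0 * f = 0 := Subtype.ext (conv_zero_left f.1)

theorem mul_zero' (f : CcAlg S) : f * 0 = 0 := Subtype.ext (conv_zero_right f.1)

theorem pull_one (φ : C(omega S, ℂ)) : pull 1 φ = φ := by
  ext χ
  exact pull_idem 1 φ (semiChars.map_one χ.1)

theorem one_mul' (f : CcAlg S) : 1 * f = f := by
  induction f using CcAlg.induction with
  | hd g φ =>
    refine (d_mul 1 g 1 φ).trans ?_
    rw [one_mul]
    refine d_congr fun χ h => ?_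
    rw [ContinuousMap.mul_apply, pull_pos _ h, ContinuousMap.one_apply, one_mul]
  | h0 => exact mul_zero' 1
  | hadd f f' h h' => rw [mul_add', h, h']
  | hsmul c f h => rw [mul_smul', h]

theorem mul_one' (f : CcAlg S) : f * 1 = f := by
  induction f using CcAlg.induction with
  | hd g φ =>
    refine (d_mul g 1 φ 1).trans ?_
    rw [mul_one, mul_one, pull_one]
  | h0 => exact zero_mul' 1
  | hadd f f' h h' => rw [add_mul', h, h']
  | hsmul c f h => rw [smul_mul', h]

noncomputable instance : Ring (CcAlg S) :=
  { (inferInstance : AddCommGroup (CcAlg S)) with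
    mul := (· * ·)
    one := 1
    left_distrib := mul_add'
    right_distrib := add_mul'
    zero_mul := zero_mul'
    mul_zero := mul_zero'
    one_mul := one_mul'
    mul_one := mul_one'
    mul_assoc := fun f f' f'' =>
      Subtype.ext (conv_assoc f.mem_span f'.mem_span f''.mem_span) }

noncomputable instance : Algebra ℂ (CcAlg S) := Algebra.ofModule smul_mul' mul_smul'

noncomputable instance : StarRing (CcAlg S) where
  star_involutive f := Subtype.ext (invol_invol f.1)
  star_mul f f' := Subtype.ext (invol_conv f.mem_span f'.mem_span)
  star_add f f' := Subtype.ext (invol_add f.1 f'.1)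

instance : StarModule ℂ (CcAlg S) where
  star_smul c f := Subtype.ext (invol_smul c f.1)

theorem d_add (g : LeftHull S) (φ ψ : C(omega S, ℂ)) : d g (φ + ψ) = d g φ + d g ψ := by
  apply Subtype.ext
  funext γ
  change delta g (φ + ψ) γ = delta g φ γ + delta g ψ γ
  by_cases h : γ ∈ bisection g <;> simp [delta, h]

theorem d_smul (g : LeftHull S) (c : ℂ) (φ : C(omega S, ℂ)) : d g (c • φ) = c • d g φ := by
  apply Subtype.ext
  funext γ
  change delta g (c • φ) γ = c • delta g φ γ
  by_cases h : γ ∈ bisection g <;> simp [delta, h]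

theorem d_one_mul (φ ψ : C(omega S, ℂ)) : d 1 (φ * ψ) = d 1 φ * d 1 ψ := by
  rw [d_mul, pull_one, mul_one]

theorem d_one_star (φ : C(omega S, ℂ)) : d 1 (star φ) = star (d 1 φ) := by
  rw [d_star]
  change _ = d 1 (pull 1 (star φ))
  rw [pull_one]

/-- The restriction of a C*-seminorm to the functions on the unit space. -/
noncomputable def restrictUnits (p : CStarSeminorm (CcAlg S)) : CStarSeminorm C(omega S, ℂ) where
  toFun φ := p (d 1 φ)
  map_zero' := by
    have : d (S := S) 1 0 = 0 := by simpa using d_smul (S := S) 1 0 0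
    rw [this, map_zero]
  add_le' φ ψ := by rw [d_add]; exact map_add_le_add _ _ _
  neg' φ := by
    have : d (S := S) 1 (-φ) = - d 1 φ := by simpa using d_smul (S := S) 1 (-1) φ
    rw [this, map_neg_eq_map]
  smul' c φ := by rw [d_smul]; exact map_smul_eq_mul _ _ _
  mul_le' φ ψ := by
    change p (d 1 (φ * ψ)) ≤ p (d 1 φ) * p (d 1 ψ)
    rw [d_one_mul]
    exact p.mul_le _ _
  star_mul_self' φ := by
    change p (d 1 (star φ * φ)) = p (d 1 φ) * p (d 1 φ)
    rw [d_one_mul, d_one_star]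
    exact p.star_mul_self _

theorem star_d_mul_d (g : LeftHull S) (φ : C(omega S, ℂ)) :
    star (d g φ) * d g φ = d 1 (pull g 1 * (star φ * φ)) := by
  rw [d_star, d_mul, pull_pull]
  apply Subtype.ext
  funext γ
  change delta (dom g).1 (pull (dom g).1 (star φ) * φ) γ = delta 1 (pull g 1 * (star φ * φ)) γ
  by_cases hγ : γ ∈ bisection (dom g).1
  · obtain ⟨χ, h, rfl⟩ := hγ
    have h' : χ.1.1 (dom g) = true := by rwa [dom_idem] at h
    have e : GP.germ (dom g).1 χ h = GP.germ 1 χ (by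
        have : dom (1 : LeftHull S) = 1 := dom_idem 1
        rw [this]; exact semiChars.map_one _) :=
      germ_eq_iff.2 ⟨rfl, dom g, by rw [(dom g).2.eq, one_mul], h'⟩
    rw [delta_germ, e, delta_germ]
    simp only [ContinuousMap.mul_apply]
    rw [pull_idem _ _ h', pull_pos _ h', ContinuousMap.one_apply, one_mul]
  · rw [delta_of_notMem _ hγ]
    by_cases h1 : γ ∈ bisection 1
    · obtain ⟨χ, h, rfl⟩ := h1
      rw [delta_germ, ContinuousMap.mul_apply, pull_neg, zero_mul]
      intro h'
      apply hγ
      exact ⟨χ, by rwa [dom_idem],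
        germ_eq_iff.2 ⟨rfl, dom g, by rw [(dom g).2.eq, one_mul], h'⟩⟩
    · rw [delta_of_notMem _ h1]

instance : HasCStarEnvelope (CcAlg S) where
  bddAbove f := by
    suffices h : ∃ C, ∀ p : CStarSeminorm (CcAlg S), p f ≤ C by
      obtain ⟨C, hC⟩ := h
      exact ⟨C, by rintro _ ⟨p, rfl⟩; exact hC p⟩
    induction f using CcAlg.induction with
    | hd g φ =>
      refine ⟨√‖pull g 1 * (star φ * φ)‖, fun p => Real.le_sqrt_of_sq_le ?_⟩
      rw [sq, ← p.star_mul_self, star_d_mul_d]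
      exact (restrictUnits p).le_norm _
    | h0 => exact ⟨0, fun p => (map_zero p.toSeminorm).le⟩
    | hadd f f' h h' =>
      obtain ⟨C, hC⟩ := h
      obtain ⟨C', hC'⟩ := h'
      exact ⟨C + C', fun p => (map_add_le_add p.toSeminorm f f').trans (add_le_add (hC p) (hC' p))⟩
    | hsmul c f h =>
      obtain ⟨C, hC⟩ := h
      refine ⟨‖c‖ * C, fun p => ?_⟩
      rw [map_smul_eq_mul]
      exact mul_le_mul_of_nonneg_left (hC p) (norm_nonneg c)

end CcAlg

variable (S) in
/-- The full groupoid C*-algebra `C*(𝒢_P(S))`: the C*-enveloping algebra of `C_c(𝒢_P(S))`. -/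
abbrev FullGPAlgebra : Type u := CStarEnvelope (CcAlg S)

/-- The indicator function of `D(s, Ω(S))` belongs to `C_c(𝒢_P(S))`. -/
theorem indicator_bisection_mem (s : S) :
    (bisection (LeftHull.tr s)).indicator (fun _ => (1 : ℂ)) ∈ Cc (GP S) := by
  have : (bisection (LeftHull.tr s)).indicator (fun _ => (1 : ℂ)) = delta (LeftHull.tr s) 1 := by
    funext γ
    by_cases h : γ ∈ bisection (LeftHull.tr s) <;> simp [delta, h]
  rw [this]
  exact delta_mem_Cc (LeftHull.tr s) 1

/-- The element `v_s = 𝟙_{D(s, Ω(S))}` of `C*(𝒢_P(S))`. -/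
noncomputable def gpGenerator (s : S) : FullGPAlgebra S :=
  CStarEnvelope.of (CcAlg S)
    ⟨(bisection (LeftHull.tr s)).indicator (fun _ => (1 : ℂ)), indicator_bisection_mem s⟩

end Groupoid

/-! ### The relations -/

section Relations

universe u w

variable {S : Type u} [LeftCancelMonoid S]

/-- The element `s₁⁻¹ t₁ ⋯ sₙ⁻¹ tₙ` of the left inverse hull given by a list of pairs
`(s₁, t₁), …, (sₙ, tₙ)`. The empty list presents the identity `e⁻¹ e`. -/
noncomputable def hullWord (l : List (S × S)) : LeftHull S :=
  (l.map fun x => (LeftHull.tr x.1)⁻¹ * LeftHull.tr x.2).prod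

theorem hullWord_inv (l : List (S × S)) :
    (hullWord l)⁻¹ = hullWord (l.reverse.map Prod.swap) := by
  induction l with
  | nil => exact Subtype.ext PEquiv.symm_refl
  | cons x l ih =>
    have h1 : hullWord (x :: l) = (LeftHull.tr x.1)⁻¹ * LeftHull.tr x.2 * hullWord l := by
      simp [hullWord]
    rw [h1, LeftHull.mul_inv', LeftHull.mul_inv', LeftHull.inv_inv', ih]
    simp [hullWord]

theorem exists_hullWord (g : LeftHull S) : ∃ l : List (S × S), hullWord l = g := by
  obtain ⟨f, hf⟩ := g
  induction hf with
  | translation s =>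
    refine ⟨[(1, s)], ?_⟩
    have : (LeftHull.tr (1 : S))⁻¹ = 1 := by
      ext x y
      rw [LeftHull.mem_inv, LeftHull.mem_one]
      change x ∈ leftTranslation 1 y ↔ _
      rw [mem_leftTranslation, one_mul, eq_comm]
    simp only [hullWord, List.map_cons, List.map_nil, List.prod_cons, List.prod_nil, mul_one,
      this, one_mul]
    rfl
  | symm hf ih =>
    obtain ⟨l, hl⟩ := ih
    exact ⟨_, (hullWord_inv l).symm.trans (by rw [hl]; rfl)⟩
  | trans hf hg ihf ihg =>
    obtain ⟨l, hl⟩ := ihf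
    obtain ⟨l', hl'⟩ := ihg
    refine ⟨l' ++ l, ?_⟩
    have : hullWord (l' ++ l) = hullWord l' * hullWord l := by simp [hullWord]
    rw [this, hl, hl']
    rfl

/-- A subset of `S` is a constructible right ideal if it has the form `s₁⁻¹ t₁ ⋯ sₙ⁻¹ tₙ S`, that
is, if it is the image of the partial bijection `s₁⁻¹ t₁ ⋯ sₙ⁻¹ tₙ`. -/
def IsConstructible (X : Set S) : Prop :=
  ∃ l : List (S × S), X = {x | ∃ y, x ∈ (hullWord l).1 y}

open Classical in
/-- The idempotent `p_X`, the identity map of the constructible ideal `X`. -/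
noncomputable def idemOf (X : Set S) (hX : IsConstructible X) : LeftHull S :=
  ⟨PEquiv.ofSet X, by
    obtain ⟨l, hl⟩ := hX
    have : PEquiv.ofSet X = (hullWord l * (hullWord l)⁻¹).1 := by
      refine PEquiv.ext fun x => Option.ext fun y => ?_
      change _ ↔ y ∈ (hullWord l * (hullWord l)⁻¹).1 x
      rw [LeftHull.mem_mul]
      change y ∈ PEquiv.ofSet X x ↔ _
      rw [PEquiv.mem_ofSet_iff]
      constructor
      · rintro ⟨rfl, hx⟩
        rw [hl] at hx
        obtain ⟨z, hz⟩ := hx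
        exact ⟨z, LeftHull.mem_inv.2 hz, hz⟩
      · rintro ⟨z, hz, hy⟩
        have hz' := LeftHull.mem_inv.1 hz
        obtain rfl := LeftHull.val_unique hz' hy
        exact ⟨rfl, by rw [hl]; exact ⟨z, hy⟩⟩
    rw [this]
    exact (hullWord l * (hullWord l)⁻¹).2⟩

variable {B : Type w} [Ring B] [StarRing B]

/-- The product `v_{s₁}* v_{t₁} ⋯ v_{sₙ}* v_{tₙ}`. -/
def algWord (v : S → B) (l : List (S × S)) : B := (l.map fun x => star (v x.1) * v x.2).prod

/-- The element `v_g`: the product `v_{s₁}* v_{t₁} ⋯ v_{sₙ}* v_{tₙ}` for some presentation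
`g = s₁⁻¹ t₁ ⋯ sₙ⁻¹ tₙ`. It is independent of the presentation when the second relation of
`HullRelations` holds. -/
noncomputable def algElem (v : S → B) (g : LeftHull S) : B :=
  algWord v (exists_hullWord g).choose

/-- The relations on a family `v_s`, `s ∈ S`. -/
structure HullRelations (v : S → B) : Prop where
  /-- `v_e = 1`. -/
  one : v 1 = 1
  /-- `v_g` is independent of the presentation of `g`. -/
  well_defined : ∀ l l' : List (S × S), hullWord l = hullWord l' → algWord v l = algWord v l'
  /-- If the map `0` with empty domain is in the left inverse hull, then `v_0 = 0`. -/
  zero : ∀ g : LeftHull S, g.1 = ⊥ → algElem v g = 0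
  /-- If `X = X₁ ∪ ⋯ ∪ Xₙ` for constructible ideals, `n ≥ 1`, then
  `∏ (v_{p_X} - v_{p_{X_i}}) = 0`. -/
  union : ∀ (n : ℕ) (X : Set S) (Y : Fin n → Set S) (hX : IsConstructible X)
    (hY : ∀ i, IsConstructible (Y i)), 0 < n → X = ⋃ i, Y i →
    (List.ofFn fun i => algElem v (idemOf X hX) - algElem v (idemOf (Y i) (hY i))).prod = 0

end Relations

universe u w

/-! Write `d g φ` for the function on D(g, Ω(S)) sending [g, χ] to φ(χ). These functions span C_c,
and they satisfy `d g φ = d g 1 * d 1 φ`, where `d 1` embeds C(Ω(S)) as the functions on the unit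
space. The algebra is therefore governed by the elements `d g 1`, which multiply like the left
inverse hull, and by C(Ω(S)), which is generated by the indicators `idemInd p` of the clopen sets
{χ(p) = 1}.

The canonical elements satisfy the relations because v_g is the image of `d g 1`. For (R3) and (R4)
the point is that a finite cover of one constructible ideal by others is respected by every χ_s,
hence by every χ in the closure Ω(S) (`GP.exists_of_cover`). Density of the generated *-algebra is
Stone–Weierstrass on Ω(S).

Conversely, let (b_s) satisfy the relations. By (R2) it yields a *-representation g ↦ v_g of the
inverse hull, and the v_p for idempotent p are commuting projections. By Gelfand duality they are
{0,1}-valued functions on a compact space K, so each point of K defines a semi-character. Relations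
(R3) and (R4) say exactly that this semi-character lies in Ω(S) (`semiChars.mem_omega_of_forall`).
Pulling functions back along K → Ω(S) gives π : C(Ω(S)) → B with π(`idemInd p`) = v_p, and π is
covariant with respect to g ↦ v_g.

It remains to put ρ(`d g φ`) = v_g π(φ). The groupoid need not be Hausdorff, and the bisections D(g,
Ω(S)) overlap, so well-definedness is the crux (`HullRelations.sum_algElem_mul_rep_eq_zero`). Near a
fixed χ, for finitely many g, the operator v_g π(h) with h supported close to χ depends only on the
germ [g, χ], and it vanishes if χ is not in the domain of g. Collecting terms by germs, the
coefficient of each germ is the value there of the given zero function. A partition of unity makes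
this local cancellation global (`sum_apply_eq_zero_of_locally`). Finally ρ extends to the
C*-envelope, and uniqueness follows from density. -/

/-! ### C*-algebraic preliminaries -/

section CStarPreliminaries

/-- The C*-seminorm `a ↦ ‖ρ a‖` of a *-homomorphism `ρ` into a C*-algebra. -/
noncomputable def CStarSeminorm.ofHom {A : Type u} [Ring A] [StarRing A] [Algebra ℂ A]
    {B : Type w} [CStarAlgebra B] (ρ : A →⋆ₐ[ℂ] B) : CStarSeminorm A where
  toFun a := ‖ρ a‖
  map_zero' := by simp
  add_le' a b := by rw [map_add]; exact norm_add_le _ _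
  neg' a := by rw [map_neg, norm_neg]
  smul' c a := by rw [map_smul, norm_smul]
  mul_le' a b := by rw [map_mul]; exact norm_mul_le _ _
  star_mul_self' a := by rw [map_mul, map_star]; exact CStarRing.norm_star_mul_self

/-- Every *-homomorphism into a C*-algebra extends to the C*-enveloping algebra. -/
theorem CStarEnvelope.exists_lift {A : Type u} [Ring A] [StarRing A] [Algebra ℂ A]
    [StarModule ℂ A] [HasCStarEnvelope A] {B : Type w} [CStarAlgebra B] (ρ : A →⋆ₐ[ℂ] B) :
    ∃ φ : CStarEnvelope A →⋆ₐ[ℂ] B, ∀ a, φ (CStarEnvelope.of A a) = ρ a := by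
  set p := maxCStarSeminorm A with hp
  let r : p.Carrier →+ B := (ρ : A →+ B)
  have hr : UniformContinuous r :=
    AddMonoidHomClass.uniformContinuous_of_bound r 1 fun a => by
      rw [one_mul]
      -- `ρ` is contractive for the largest C*-seminorm. The supremum ranges over seminorms on `A`,
      -- not over representations, so `B` may live in any universe.
      exact (CStarSeminorm.ofHom ρ).le_iSup a
  let F : p.Completion → B := UniformSpace.Completion.extension r
  have hF : Continuous F := UniformSpace.Completion.continuous_extension
  have hFc : ∀ a : A, F (p.coe a) = ρ a := fun a =>
    UniformSpace.Completion.extension_coe hr (show p.Carrier from a)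
  have hadd : ∀ x y, F (x + y) = F x + F y := fun x y => by
    refine p.induction (P := fun x => F (x + y) = F x + F y) x
      (isClosed_eq (by fun_prop) (by fun_prop)) fun a => ?_
    refine p.induction (P := fun y => F (p.coe a + y) = F (p.coe a) + F y) y
      (isClosed_eq (by fun_prop) (by fun_prop)) fun b => ?_
    rw [← p.coe_add, hFc, hFc, hFc, map_add]
  have hmul : ∀ x y, F (x * y) = F x * F y := fun x y => by
    refine p.induction (P := fun x => F (x * y) = F x * F y) x
      (isClosed_eq (by fun_prop) (by fun_prop)) fun a => ?_
    refine p.induction (P := fun y => F (p.coe a * y) = F (p.coe a) * F y) y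
      (isClosed_eq (by fun_prop) (by fun_prop)) fun b => ?_
    rw [← p.coe_mul, hFc, hFc, hFc, map_mul]
  refine ⟨{ toFun := F, map_one' := ?_, map_mul' := hmul, map_zero' := ?_, map_add' := hadd,
            commutes' := fun c => ?_, map_star' := fun x => ?_ }, fun a => hFc a⟩
  · rw [← p.coe_one, hFc, map_one]
  · change F 0 = 0
    rw [← p.coe_zero, hFc, map_zero]
  · change F (algebraMap ℂ _ c) = _
    rw [Algebra.algebraMap_eq_smul_one, ← p.coe_one, ← p.coe_smul, hFc, map_smul, map_one,
      Algebra.algebraMap_eq_smul_one]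
  · change F (star x) = star (F x)
    refine p.induction (P := fun x => F (star x) = star (F x)) x
      (isClosed_eq (hF.comp p.continuous_star) (by fun_prop)) fun a => ?_
    rw [← p.coe_star, hFc, hFc, map_star]

/-- Commuting self-adjoint elements of a C*-algebra lie in the image of an injective
*-homomorphism from an algebra of continuous functions. -/
theorem exists_injective_continuousMap_hom {B : Type w} [CStarAlgebra B] {ι : Type*} (e : ι → B)
    (hsa : ∀ i, star (e i) = e i) (hcomm : ∀ i j, e i * e j = e j * e i) :
    ∃ (K : Type w) (_ : TopologicalSpace K) (_ : CompactSpace K) (J : C(K, ℂ) →⋆ₐ[ℂ] B),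
      Function.Injective J ∧ ∃ f : ι → C(K, ℂ), ∀ i, J (f i) = e i := by
  -- The double commutant of the family is automatically closed, hence a C*-algebra. It remains to
  -- see that it contains the family and is commutative.
  let C : StarSubalgebra ℂ B :=
    StarSubalgebra.centralizer ℂ (StarSubalgebra.centralizer ℂ (Set.range e) : Set B)
  have hT : ∀ i, e i ∈ StarSubalgebra.centralizer ℂ (Set.range e) := fun i => by
    rw [StarSubalgebra.mem_centralizer_iff]
    rintro _ ⟨j, rfl⟩
    exact ⟨hcomm j i, by rw [hsa]; exact hcomm j i⟩
  have hC : ∀ i, e i ∈ C := fun i => by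
    rw [StarSubalgebra.mem_centralizer_iff]
    intro g hg
    have hg' := StarSubalgebra.mem_centralizer_iff ℂ |>.1 hg (e i) ⟨i, rfl⟩
    have hg'' := StarSubalgebra.mem_centralizer_iff ℂ |>.1 (star_mem hg) (e i) ⟨i, rfl⟩
    exact ⟨hg'.1.symm, hg''.1.symm⟩
  -- The family lies in its own commutant, so the double commutant lies in the single commutant. Its
  -- elements therefore commute with one another.
  have hCT : ∀ x ∈ C, x ∈ StarSubalgebra.centralizer ℂ (Set.range e) := fun x hx => by
    rw [StarSubalgebra.mem_centralizer_iff]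
    rintro _ ⟨i, rfl⟩
    exact StarSubalgebra.mem_centralizer_iff ℂ |>.1 hx (e i) (hT i)
  have hclosed : IsClosed (C : Set B) := Set.isClosed_centralizer _
  let _ : CommCStarAlgebra C :=
    { (inferInstance : CStarAlgebra C) with
      mul_comm := fun x y => Subtype.ext
        ((StarSubalgebra.mem_centralizer_iff ℂ |>.1 y.2 x.1 (hCT _ x.2)).1) }
  -- The required injection is the inverse Gelfand transform followed by the inclusion of `C` in
  -- `B`.
  let G := gelfandStarTransform C
  refine ⟨WeakDual.characterSpace ℂ C, inferInstance, inferInstance,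
    C.subtype.comp (G.symm : C(WeakDual.characterSpace ℂ C, ℂ) →⋆ₐ[ℂ] C), ?_,
    fun i => G ⟨e i, hC i⟩, fun i => ?_⟩
  · exact Subtype.val_injective.comp G.symm.injective
  · change ((G.symm (G ⟨e i, hC i⟩) : C) : B) = e i
    rw [G.symm_apply_apply]

end CStarPreliminaries

open LeftHull Idem semiChars GP

/-! ### Consequences of the relations -/

section AlgWord

variable {S : Type u} {B : Type w} [Ring B] [StarRing B] {v : S → B}

theorem algWord_append (l l' : List (S × S)) :
    algWord v (l ++ l') = algWord v l * algWord v l' := by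
  simp [algWord]

/-- The counterpart of `hullWord_inv`: the same reversed and swapped word presents the inverse in
the hull. Under (R2) this turns inversion into the adjoint. -/
theorem star_algWord (l : List (S × S)) :
    star (algWord v l) = algWord v (l.reverse.map Prod.swap) := by
  induction l with
  | nil => simp [algWord]
  | cons x l ih =>
    have h1 : algWord v (x :: l) = star (v x.1) * v x.2 * algWord v l := by simp [algWord]
    rw [h1, star_mul, star_mul, star_star, ih, List.reverse_cons, List.map_append, algWord_append]
    simp [algWord]

end AlgWord

section RelationConsequences

variable {S : Type u} [LeftCancelMonoid S]

/-! ### Products and idempotents in the left inverse hull -/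

theorem hullWord_append (l l' : List (S × S)) :
    hullWord (l ++ l') = hullWord l * hullWord l' := by
  simp [hullWord]

theorem tr_one : tr (1 : S) = 1 := by
  ext x y
  rw [mem_one]
  change y ∈ leftTranslation 1 x ↔ _
  rw [mem_leftTranslation, one_mul]

theorem LeftHull.inv_one' : (1 : LeftHull S)⁻¹ = 1 := Subtype.ext PEquiv.symm_refl

theorem hullWord_one_pair (s : S) : hullWord [(1, s)] = tr s := by
  simp [hullWord, tr_one, LeftHull.inv_one']

theorem LeftHull.mul_inv_mul (g : LeftHull S) : g * g⁻¹ * g = g := by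
  ext x y
  rw [mul_assoc, mem_mul]
  constructor
  · rintro ⟨z, hz, hy⟩
    have := (dom g).eq_of_mem (show z ∈ (dom g).1.1 x from hz)
    subst this
    exact hy
  · intro hy
    exact ⟨x, mem_dom.2 ⟨y, hy⟩, hy⟩

/-- Moving an idempotent past h conjugates it to h⁻¹ p h. Applied to v, this becomes the covariance
of π on indicator functions. -/
theorem Idem.mul_conj (h : LeftHull S) (p : Idem S) : p.1 * h = h * (conj h p).1 := by
  ext x y
  rw [mem_mul, mem_mul]
  constructor
  · rintro ⟨z, hz, hy⟩
    obtain rfl := p.eq_of_mem hy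
    exact ⟨x, mem_conj.2 ⟨z, hz, hy⟩, hz⟩
  · rintro ⟨z, hz, hy⟩
    obtain rfl := (conj h p).eq_of_mem hz
    obtain ⟨w, hw, hwp⟩ := mem_conj.1 hz
    obtain rfl := val_unique hw hy
    exact ⟨w, hw, hwp⟩

theorem Idem.inv_val (p : Idem S) : p.1⁻¹ = p.1 := by
  ext x y
  rw [mem_inv]
  constructor
  · intro h; obtain rfl := p.eq_of_mem h; exact h
  · intro h; obtain rfl := p.eq_of_mem h; exact h

/-- The constructible ideal whose identity map is the idempotent `p`. -/
def Idem.support (p : Idem S) : Set S := {x | x ∈ p.1.1 x}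

/-- An idempotent is the identity map of its image, so any word presenting it also exhibits that
image as constructible. Together with `Idem.idemOf_support` this translates between abstract
idempotents and the maps p_X of relation (R4). -/
theorem Idem.isConstructible_support (p : Idem S) : IsConstructible p.support := by
  obtain ⟨l, hl⟩ := exists_hullWord p.1
  refine ⟨l, ?_⟩
  rw [hl]
  ext x
  refine ⟨fun h => ⟨x, h⟩, ?_⟩
  rintro ⟨y, hy⟩
  obtain rfl := p.eq_of_mem hy
  exact hy

theorem mem_idemOf {X : Set S} (hX : IsConstructible X) {x y : S} :
    y ∈ (idemOf X hX).1 x ↔ x = y ∧ x ∈ X := by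
  classical
  change y ∈ PEquiv.ofSet X x ↔ _
  rw [PEquiv.mem_ofSet_iff]
  constructor
  · rintro ⟨rfl, h⟩; exact ⟨rfl, h⟩
  · rintro ⟨rfl, h⟩; exact ⟨rfl, h⟩

theorem Idem.idemOf_support (p : Idem S) : idemOf p.support p.isConstructible_support = p.1 := by
  ext x y
  rw [mem_idemOf]
  constructor
  · rintro ⟨rfl, h⟩; exact h
  · intro h; obtain rfl := p.eq_of_mem h; exact ⟨rfl, h⟩

theorem isIdempotentElem_idemOf {X : Set S} (hX : IsConstructible X) :
    IsIdempotentElem (idemOf X hX) :=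
  isIdempotentElem_iff.2 fun _ _ h => ((mem_idemOf hX).1 h).1

theorem LeftHull.eq_bot_iff {g : LeftHull S} : g.1 = ⊥ ↔ ∀ x y, y ∉ g.1 x := by
  constructor
  · intro h x y hy
    rw [h] at hy
    simp at hy
  · intro h
    refine PEquiv.ext fun x => Option.ext fun y => ?_
    simpa using h x y

variable {B : Type w} [Ring B] [StarRing B] {v : S → B}

/-! ### The *-representation g ↦ v_g of the left inverse hull -/

namespace HullRelations

/-- By (R2) the presentation picked in `algElem` does not matter. Products, units and adjoints of
the v_g can then be computed on words. -/
theorem algElem_hullWord (hv : HullRelations v) (l : List (S × S)) :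
    algElem v (hullWord l) = algWord v l :=
  hv.well_defined _ _ (exists_hullWord (hullWord l)).choose_spec

theorem algElem_mul (hv : HullRelations v) (g h : LeftHull S) :
    algElem v (g * h) = algElem v g * algElem v h := by
  obtain ⟨l, rfl⟩ := exists_hullWord g
  obtain ⟨l', rfl⟩ := exists_hullWord h
  rw [← hullWord_append, hv.algElem_hullWord, hv.algElem_hullWord, hv.algElem_hullWord,
    algWord_append]

theorem algElem_one (hv : HullRelations v) : algElem v 1 = 1 := by
  have : (1 : LeftHull S) = hullWord [] := rfl
  rw [this, hv.algElem_hullWord]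
  rfl

theorem algElem_inv (hv : HullRelations v) (g : LeftHull S) :
    algElem v g⁻¹ = star (algElem v g) := by
  obtain ⟨l, rfl⟩ := exists_hullWord g
  rw [hullWord_inv, hv.algElem_hullWord, hv.algElem_hullWord, star_algWord]

theorem algElem_tr (hv : HullRelations v) (s : S) : algElem v (tr s) = v s := by
  rw [← hullWord_one_pair, hv.algElem_hullWord]
  simp [algWord, hv.one]

theorem star_algElem_idem (hv : HullRelations v) (p : Idem S) :
    star (algElem v p.1) = algElem v p.1 := by
  rw [← hv.algElem_inv, p.inv_val]

theorem algElem_idem_mul (hv : HullRelations v) (p q : Idem S) :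
    algElem v (p * q).1 = algElem v p.1 * algElem v q.1 := hv.algElem_mul p.1 q.1

theorem algElem_idem_comm (hv : HullRelations v) (p q : Idem S) :
    algElem v p.1 * algElem v q.1 = algElem v q.1 * algElem v p.1 := by
  rw [← hv.algElem_idem_mul, ← hv.algElem_idem_mul, Idem.mul_comm']

/-- Follows from g g⁻¹ g = g. It makes v_g insensitive to functions supported off the domain of g.
-/
theorem algElem_mul_dom (hv : HullRelations v) (g : LeftHull S) :
    algElem v g * algElem v (dom g).1 = algElem v g := by
  rw [← hv.algElem_mul]
  change algElem v (g * (g⁻¹ * g)) = _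
  rw [← mul_assoc, LeftHull.mul_inv_mul]

/-- If the ideals of `p₁, …, pₙ` cover the ideal of `q`, then `∏ (v_q - v_{q pᵢ}) = 0`. -/
theorem prod_sub_eq_zero (hv : HullRelations v) {n : ℕ} (hn : 0 < n) (q : Idem S)
    (p : Fin n → Idem S) (H : ∀ s ∈ q.support, ∃ i, s ∈ (p i).support) :
    (List.ofFn fun i => algElem v q.1 - algElem v (q * p i).1).prod = 0 := by
  -- The pᵢ may extend beyond q. Cutting them down to q pᵢ turns the cover into an equality of
  -- constructible ideals, as (R4) demands.
  have hU : q.support = ⋃ i, (q * p i).support := by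
    ext s
    rw [Set.mem_iUnion]
    constructor
    · intro hs
      obtain ⟨i, hi⟩ := H s hs
      exact ⟨i, mem_mul_iff.2 ⟨hs, hi⟩⟩
    · rintro ⟨i, hi⟩
      exact (mem_mul_iff.1 hi).1
  have := hv.union n q.support (fun i => (q * p i).support) q.isConstructible_support
    (fun i => (q * p i).isConstructible_support) hn hU
  simpa only [Idem.idemOf_support] using this

end HullRelations

end RelationConsequences

/-! ### The space `Ω(S)` and its continuous functions -/

section Omega

variable {S : Type u} [LeftCancelMonoid S]

/-- A semi-character `χ` belongs to `Ω(S)` if, whenever `χ(q) = 1` and `χ(pᵢ) = 0` for finitely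
many `pᵢ`, the ideal of `q` is not covered by the ideals of the `pᵢ`. -/
theorem semiChars.mem_omega_of_forall {χ : semiChars S}
    (H : ∀ (q : Idem S) (n : ℕ) (p : Fin n → Idem S), χ.1 q = true → (∀ i, χ.1 (p i) ≠ true) →
      ∃ s ∈ q.support, ∀ i, s ∉ (p i).support) : χ ∈ omega S := by
  classical
  rw [omega, mem_closure_iff]
  intro O hO hχ
  obtain ⟨W, hW, rfl⟩ := isOpen_induced_iff.1 hO
  -- A basic neighbourhood of χ constrains only the finitely many coordinates in `I`; a χ_s agreeing
  -- with χ on `I` is sought.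
  obtain ⟨I, u, hu, hIW⟩ := isOpen_pi_iff.1 hW χ.1 hχ
  -- The witness is the product of those p in J with χ(p) = 1, with 1 for the empty product.
  have hq : ∀ J : Finset (Idem S), ∃ q : Idem S, χ.1 q = true ∧
      ∀ s ∈ q.support, ∀ p ∈ J, χ.1 p = true → s ∈ p.support := by
    intro J
    induction J using Finset.induction_on with
    | empty => exact ⟨1, semiChars.map_one χ, by simp⟩
    | insert p J _ ih =>
      obtain ⟨q, hq, hqJ⟩ := ih
      by_cases hp : χ.1 p = true
      · refine ⟨p * q, (map_mul_iff χ p q).2 ⟨hp, hq⟩, fun s hs r hr hχr => ?_⟩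
        obtain ⟨hsp, hsq⟩ := mem_mul_iff.1 hs
        rcases Finset.mem_insert.1 hr with rfl | hr
        · exact hsp
        · exact hqJ s hsq r hr hχr
      · refine ⟨q, hq, fun s hs r hr hχr => ?_⟩
        rcases Finset.mem_insert.1 hr with rfl | hr
        · exact absurd hχr hp
        · exact hqJ s hs r hr hχr
  obtain ⟨q, hq, hqI⟩ := hq I
  -- These are the coordinates where χ vanishes. A point of q outside all their ideals defines a χ_s
  -- that agrees with χ on all of `I`.
  let F := I.filter fun p => χ.1 p ≠ true
  obtain ⟨s, hsq, hs⟩ := H q F.card (fun i => (F.equivFin.symm i).1) hq fun i =>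
    (Finset.mem_filter.1 (F.equivFin.symm i).2).2
  refine ⟨point s, hIW ?_, s, rfl⟩
  intro p hp
  have : (point s).1 p = χ.1 p := by
    rw [Bool.eq_iff_iff, point_iff]
    constructor
    · intro hsp
      by_contra hχp
      have hpF : p ∈ F := Finset.mem_filter.2 ⟨hp, hχp⟩
      refine hs (F.equivFin ⟨p, hpF⟩) ?_
      rw [Equiv.symm_apply_apply]
      exact hsp
    · exact hqI s hsq p hp
  rw [this]
  exact (hu p hp).2

/-- Finite cover relations of ideals hold for all semi-characters in `Ω(S)`. -/
theorem GP.exists_of_cover {n : ℕ} (q : Idem S) (p : Fin n → Idem S)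
    (H : ∀ s ∈ q.support, ∃ i, s ∈ (p i).support) (χ : omega S) (hχ : χ.1.1 q = true) :
    ∃ i, χ.1.1 (p i) = true := by
  by_contra! hne
  -- If every χ(pᵢ) were 0, this would be an open neighbourhood of χ. It would contain some χ_s with
  -- s in the ideal of q but in none of the others. The case n = 0 is allowed and says that χ(q)
  -- cannot be 1 when q has empty ideal.
  have ho : IsOpen ({χ : semiChars S | χ.1 q = true} ∩
      ⋂ i, {χ : semiChars S | χ.1 (p i) = true}ᶜ) :=
    (isClopen_eval q).isOpen.inter
      (isOpen_iInter_of_finite fun i => (isClopen_eval (p i)).compl.isOpen)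
  obtain ⟨_, ⟨hsq, hsp⟩, s, rfl⟩ := mem_closure_iff.1 χ.2 _ ho ⟨hχ, Set.mem_iInter.2 hne⟩
  obtain ⟨i, hi⟩ := H s (point_iff.1 hsq)
  exact Set.mem_iInter.1 hsp i (point_iff.2 hi)

/-- The indicator function of `{χ ∈ Ω(S) | χ(p) = 1}`. -/
noncomputable def idemInd (p : Idem S) : C(omega S, ℂ) := pull p.1 1

theorem idemInd_pos {p : Idem S} {χ : omega S} (h : χ.1.1 p = true) : idemInd p χ = 1 := by
  rw [idemInd, pull_idem p 1 h, ContinuousMap.one_apply]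

theorem idemInd_neg {p : Idem S} {χ : omega S} (h : ¬ χ.1.1 p = true) : idemInd p χ = 0 := by
  rw [idemInd, pull_neg]
  rwa [dom_idem]

theorem star_idemInd (p : Idem S) : star (idemInd p) = idemInd p := by
  ext χ
  by_cases h : χ.1.1 p = true
  · simp [idemInd_pos h]
  · simp [idemInd_neg h]

/-- The value of χ(h⁻¹ · h) at p is χ(h⁻¹ p h) by definition of the action. Off the domain of h both
sides vanish, because h⁻¹ p h ≤ h⁻¹ h. -/
theorem pull_idemInd (h : LeftHull S) (p : Idem S) : pull h (idemInd p) = idemInd (conj h p) := by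
  ext χ
  by_cases hχ : χ.1.1 (dom h) = true
  · rw [pull_pos _ hχ]
    by_cases hp : χ.1.1 (conj h p) = true
    · rw [idemInd_pos hp, idemInd_pos]
      exact hp
    · rw [idemInd_neg hp, idemInd_neg]
      exact hp
  · rw [pull_neg _ hχ, idemInd_neg]
    rw [← one_mul' p, Idem.mul_comm', conj_mul', conj_one, Idem.mul_comm', map_mul_iff]
    exact fun h' => hχ h'.1

/-- The indicator functions of idempotents generate the algebra of continuous functions. -/
@[elab_as_elim]
theorem continuousMap_omega_induction {P : C(omega S, ℂ) → Prop} (φ : C(omega S, ℂ))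
    (hc : IsClosed {φ | P φ}) (hind : ∀ p, P (idemInd p)) (halg : ∀ c, P (algebraMap ℂ _ c))
    (hadd : ∀ φ ψ, P φ → P ψ → P (φ + ψ)) (hmul : ∀ φ ψ, P φ → P ψ → P (φ * ψ)) : P φ := by
  let A : StarSubalgebra ℂ C(omega S, ℂ) := StarAlgebra.adjoin ℂ (Set.range idemInd)
  -- Stone–Weierstrass: distinct semi-characters differ at some idempotent p, and then `idemInd p`
  -- separates them.
  have hA : A.topologicalClosure = ⊤ := by
    apply ContinuousMap.starSubalgebra_topologicalClosure_eq_top_of_separatesPoints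
    intro χ ψ hne
    have : ∃ p, χ.1.1 p ≠ ψ.1.1 p := by
      by_contra! h
      exact hne (Subtype.ext (Subtype.ext (funext h)))
    obtain ⟨p, hp⟩ := this
    refine ⟨idemInd p, ⟨idemInd p, StarAlgebra.subset_adjoin ℂ _ ⟨p, rfl⟩, rfl⟩, ?_⟩
    by_cases h1 : χ.1.1 p = true
    · have h2 : ¬ ψ.1.1 p = true := fun h2 => hp (h1.trans h2.symm)
      rw [idemInd_pos h1, idemInd_neg h2]
      exact one_ne_zero
    · have h2 : ψ.1.1 p = true := by
        rw [Bool.not_eq_true] at h1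
        rw [h1] at hp
        simpa using hp.symm
      rw [idemInd_neg h1, idemInd_pos h2]
      exact zero_ne_one
  have hAP : ∀ ψ ∈ A, P ψ := by
    intro ψ hψ
    -- The indicators are self-adjoint, so the *-algebra they generate is already the algebra they
    -- generate. This is why no hypothesis about `star` is needed.
    have hstar : star (Set.range (idemInd (S := S))) = Set.range idemInd := by
      ext ψ
      constructor
      · rintro ⟨p, hp⟩
        exact ⟨p, by rw [← star_idemInd, hp, star_star]⟩
      · rintro ⟨p, rfl⟩
        exact ⟨p, (star_idemInd p).symm⟩
    have h' : ψ ∈ A.toSubalgebra := hψ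
    rw [StarAlgebra.adjoin_toSubalgebra, hstar, Set.union_self] at h'
    clear hψ
    induction h' using Algebra.adjoin_induction with
    | mem ψ h => obtain ⟨p, rfl⟩ := h; exact hind p
    | algebraMap c => exact halg c
    | add ψ ψ' _ _ h h' => exact hadd _ _ h h'
    | mul ψ ψ' _ _ h h' => exact hmul _ _ h h'
  have hφ : φ ∈ closure (A : Set C(omega S, ℂ)) := by
    rw [← StarSubalgebra.topologicalClosure_coe, hA]
    trivial
  exact closure_minimal hAP hc hφ

end Omega

open scoped CStarAlgebra

/-! ### Localization of sums of linear maps on continuous functions -/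

section Localization

/-- Let `Λᵢ` be continuous linear maps on `C(X, ℂ)` for a compact Hausdorff space `X`. If every
point `x` has a neighbourhood `U` with `∑ φᵢ(x) Λᵢ(h) = 0` for all `h` supported in `U`, then
`∑ Λᵢ(φᵢ) = 0`. -/
theorem sum_apply_eq_zero_of_locally {X : Type*} [TopologicalSpace X] [CompactSpace X] [T2Space X]
    {E : Type*} [NormedAddCommGroup E] [NormedSpace ℂ E] {ι : Type*} (I : Finset ι)
    (φ : ι → C(X, ℂ)) (Λ : ι → C(X, ℂ) →L[ℂ] E)
    (H : ∀ x : X, ∃ U : Set X, IsOpen U ∧ x ∈ U ∧ ∀ h : C(X, ℂ), (∀ y ∉ U, h y = 0) →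
      ∑ i ∈ I, φ i x • Λ i h = 0) : ∑ i ∈ I, Λ i (φ i) = 0 := by
  -- The constant in front of ε is independent of ε, so letting ε tend to 0 from above gives the
  -- claim.
  suffices hε : ∀ ε : ℝ, 0 < ε → ‖∑ i ∈ I, Λ i (φ i)‖ ≤ (∑ i ∈ I, ‖Λ i‖) * ε by
    have hlim : Filter.Tendsto (fun ε : ℝ => (∑ i ∈ I, ‖Λ i‖) * ε) (nhdsWithin 0 (Set.Ioi 0))
        (nhds 0) := by
      have : Filter.Tendsto (fun ε : ℝ => (∑ i ∈ I, ‖Λ i‖) * ε) (nhds 0) (nhds 0) := by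
        simpa using (continuous_const_mul (∑ i ∈ I, ‖Λ i‖)).tendsto 0
      exact this.mono_left nhdsWithin_le_nhds
    have := ge_of_tendsto hlim (Filter.eventually_of_mem self_mem_nhdsWithin hε)
    exact norm_le_zero_iff.1 this
  intro ε hε
  choose U hUo hxU hU using H
  -- Shrink `U x` so that each of the finitely many `φ i` varies by less than ε from its value at x.
  -- A finite subcover then carries a partition of unity.
  let V : X → Set X := fun x => U x ∩ ⋂ i ∈ I, {y | ‖φ i y - φ i x‖ < ε}
  have hVo : ∀ x, IsOpen (V x) := fun x =>
    (hUo x).inter (isOpen_biInter_finset fun i _ => isOpen_lt (by fun_prop) continuous_const)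
  have hxV : ∀ x, x ∈ V x := fun x => ⟨hxU x, by simp [hε]⟩
  obtain ⟨t, ht⟩ := isCompact_univ.elim_finite_subcover V hVo
    fun x _ => Set.mem_iUnion.2 ⟨x, hxV x⟩
  obtain ⟨f, hf⟩ := PartitionOfUnity.exists_isSubordinate (ι := t) isClosed_univ
    (fun x => V x.1) (fun x => hVo x.1) (fun y hy => by
      obtain ⟨x, hx, hy⟩ := Set.mem_iUnion₂.1 (ht hy)
      exact Set.mem_iUnion.2 ⟨⟨x, hx⟩, hy⟩)
  let h : t → C(X, ℂ) := fun x => ⟨fun y => (f x y : ℂ), by fun_prop⟩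
  have hsum : ∀ y, ∑ x, f x y = 1 := fun y => by
    rw [← finsum_eq_sum_of_fintype]
    exact f.sum_eq_one (Set.mem_univ y)
  have hzero : ∀ (x : t) (y : X), y ∉ V x.1 → f x y = 0 := fun x y hy => by
    by_contra hne
    exact hy (hf x (subset_closure hne))
  -- Freeze each `φ i` at the centre of every patch. The local hypothesis kills the sum for `ψ`
  -- patch by patch, and `φ i - ψ i` is pointwise a convex combination of differences smaller than
  -- ε.
  let ψ : ι → C(X, ℂ) := fun i => ∑ x : t, φ i x.1 • h x
  have hψ : ∑ i ∈ I, Λ i (ψ i) = 0 := by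
    simp only [ψ, map_sum, map_smul]
    rw [Finset.sum_comm]
    refine Finset.sum_eq_zero fun x _ => hU x.1 (h x) fun y hy => ?_
    have : f x y = 0 := hzero x y fun hy' => hy hy'.1
    change (f x y : ℂ) = 0
    rw [this, Complex.ofReal_zero]
  have hφψ : ∀ i ∈ I, ‖φ i - ψ i‖ ≤ ε := fun i hi => by
    refine (ContinuousMap.norm_le _ hε.le).2 fun y => ?_
    have e1 : (φ i - ψ i) y = ∑ x : t, (f x y : ℂ) * (φ i y - φ i x.1) := by
      have : (∑ x : t, (f x y : ℂ)) = 1 := by exact_mod_cast hsum y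
      simp only [mul_sub, Finset.sum_sub_distrib, ← Finset.sum_mul, this, one_mul]
      simp [ψ, h, ContinuousMap.sum_apply, mul_comm]
    rw [e1]
    calc ‖∑ x : t, (f x y : ℂ) * (φ i y - φ i x.1)‖
        ≤ ∑ x : t, ‖(f x y : ℂ) * (φ i y - φ i x.1)‖ := norm_sum_le _ _
      _ ≤ ∑ x : t, f x y * ε := by
          refine Finset.sum_le_sum fun x _ => ?_
          rw [norm_mul, Complex.norm_real, Real.norm_of_nonneg (f.nonneg x y)]
          by_cases hy : y ∈ V x.1
          · exact mul_le_mul_of_nonneg_left (Set.mem_iInter₂.1 hy.2 i hi).le (f.nonneg x y)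
          · rw [hzero x y hy, zero_mul, zero_mul]
      _ = ε := by rw [← Finset.sum_mul, hsum, one_mul]
  have e2 : ∑ i ∈ I, Λ i (φ i) = ∑ i ∈ I, Λ i (φ i - ψ i) := by
    simp only [map_sub, Finset.sum_sub_distrib, hψ, sub_zero]
  rw [e2, Finset.sum_mul]
  refine (norm_sum_le _ _).trans (Finset.sum_le_sum fun i hi => ?_)
  exact ((Λ i).le_opNorm _).trans (mul_le_mul_of_nonneg_left (hφψ i hi) (norm_nonneg _))

end Localization

/-! ### The canonical generators -/

section Generators

variable {S : Type u} [LeftCancelMonoid S]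

namespace CcAlg

/-- The pulled-back constant 1 is the indicator of the domain of h, which is 1 wherever g h is
defined. Thus g ↦ `d g 1` is multiplicative, and with `star_d_one` it is a *-representation of the
hull. -/
theorem d_one_mul_d_one (g h : LeftHull S) : d g 1 * d h 1 = d (g * h) 1 := by
  rw [d_mul]
  refine d_congr fun χ hχ => ?_
  obtain ⟨hh, -⟩ := (dom_mul_iff _ _ _).1 hχ
  rw [mul_one, pull_pos _ hh, ContinuousMap.one_apply, ContinuousMap.one_apply]

theorem star_d_one (g : LeftHull S) : star (d g 1) = d g⁻¹ 1 := by
  rw [d_star]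
  refine d_congr fun χ hχ => ?_
  rw [star_one, pull_pos _ hχ, ContinuousMap.one_apply, ContinuousMap.one_apply]

/-- The germs [p, χ] and [e, χ] coincide when χ(p) = 1, so D(p, Ω(S)) lies in the unit space.
Algebraically, `d p.1 1` is a projection, hence equal to its own `star a * a`, which `star_d_mul_d`
computes as a function on units. -/
theorem d_idem (p : Idem S) : d p.1 1 = d 1 (idemInd p) := by
  have h1 := star_d_mul_d p.1 1
  rwa [star_one, mul_one, mul_one, star_d_one, d_one_mul_d_one, p.inv_val, p.2.eq] at h1

theorem d_eq_mul (g : LeftHull S) (φ : C(omega S, ℂ)) : d g φ = d g 1 * d 1 φ := by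
  rw [d_mul, mul_one, pull_one, one_mul]

variable (S) in
/-- The inclusion of the continuous functions on the unit space. -/
noncomputable def unitsHom : C(omega S, ℂ) →⋆ₐ[ℂ] CcAlg S where
  toFun φ := d 1 φ
  map_one' := rfl
  map_mul' := d_one_mul
  map_zero' := by simpa using d_smul (S := S) 1 0 0
  map_add' := d_add 1
  commutes' c := by
    rw [Algebra.algebraMap_eq_smul_one, Algebra.algebraMap_eq_smul_one, d_smul]
    rfl
  map_star' := d_one_star

/-- The empty ideal is covered by zero ideals, so no χ in Ω(S) takes the value 1 on it. Membership
in Ω(S) matters here: the constant semi-character 1 would not vanish at 0. -/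
theorem d_eq_zero_of_eq_bot {g : LeftHull S} (hg : g.1 = ⊥) : d g 1 = 0 := by
  have : d g 1 = d g 0 := d_congr fun χ hχ => by
    obtain ⟨i, -⟩ := GP.exists_of_cover (dom g) (Fin.elim0 : Fin 0 → Idem S) (fun s hs => by
      obtain ⟨y, hy⟩ := mem_dom.1 hs
      exact absurd hy (LeftHull.eq_bot_iff.1 hg s y)) χ hχ
    exact i.elim0
  rw [this]
  simpa using d_smul g 0 0

end CcAlg

open CcAlg

theorem gpGenerator_eq (s : S) : gpGenerator s = CStarEnvelope.of (CcAlg S) (d (tr s) 1) := by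
  rw [gpGenerator]
  congr 1

/-- The right side depends only on the element presented by the word, which is (R2) for the
canonical generators. -/
theorem algWord_gpGenerator (l : List (S × S)) :
    algWord gpGenerator l = CStarEnvelope.of (CcAlg S) (d (hullWord l) 1) := by
  induction l with
  | nil => exact (map_one (CStarEnvelope.of (CcAlg S))).symm
  | cons x l ih =>
    have h1 : algWord (gpGenerator (S := S)) (x :: l) =
        star (gpGenerator x.1) * gpGenerator x.2 * algWord gpGenerator l := by simp [algWord]
    have h2 : hullWord (x :: l) = (tr x.1)⁻¹ * tr x.2 * hullWord l := by simp [hullWord]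
    rw [h1, h2, ih, gpGenerator_eq, gpGenerator_eq, ← map_star,
      ← _root_.map_mul, ← _root_.map_mul, star_d_one,
      d_one_mul_d_one, d_one_mul_d_one]

theorem algElem_gpGenerator (g : LeftHull S) :
    algElem gpGenerator g = CStarEnvelope.of (CcAlg S) (d g 1) := by
  rw [algElem, algWord_gpGenerator, (exists_hullWord g).choose_spec]

/-- This is (R4) inside C(Ω(S)), checked pointwise. If χ(q) = 1, the cover forces some χ(pᵢ) = 1 and
that factor vanishes; if χ(q) = 0, every factor vanishes because pᵢ ≤ q. -/
theorem prod_idemInd_sub_eq_zero {n : ℕ} (hn : 0 < n) (q : Idem S) (p : Fin n → Idem S)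
    (hU : q.support = ⋃ i, (p i).support) :
    (List.ofFn fun i => idemInd q - idemInd (p i)).prod = 0 := by
  ext χ
  rw [List.prod_ofFn, ContinuousMap.prod_apply, ContinuousMap.zero_apply]
  by_cases hχ : χ.1.1 q = true
  · obtain ⟨i, hi⟩ := GP.exists_of_cover q p
      (fun s hs => by rw [hU] at hs; exact Set.mem_iUnion.1 hs) χ hχ
    refine Finset.prod_eq_zero (Finset.mem_univ i) ?_
    rw [ContinuousMap.sub_apply, idemInd_pos hχ, idemInd_pos hi, sub_self]
  -- Here n ≥ 1 is essential: an empty product would be 1.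
  · refine Finset.prod_eq_zero (Finset.mem_univ ⟨0, hn⟩) ?_
    rw [ContinuousMap.sub_apply, idemInd_neg hχ, idemInd_neg, sub_self]
    intro h
    have hle : p ⟨0, hn⟩ * q = p ⟨0, hn⟩ := Idem.ext' fun x => by
      rw [mem_mul_iff]
      refine ⟨fun h => h.1, fun h => ⟨h, ?_⟩⟩
      have : x ∈ q.support := by rw [hU]; exact Set.mem_iUnion.2 ⟨_, h⟩
      exact this
    rw [← hle, map_mul_iff] at h
    exact hχ h.2

theorem hullRelations_gpGenerator : HullRelations (gpGenerator : S → FullGPAlgebra S) where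
  one := by
    rw [gpGenerator_eq, tr_one]
    exact map_one (CStarEnvelope.of (CcAlg S))
  well_defined l l' h := by rw [algWord_gpGenerator, algWord_gpGenerator, h]
  zero g hg := by rw [algElem_gpGenerator, d_eq_zero_of_eq_bot hg, map_zero]
  union n X Y hX hY hn hXY := by
    let q : Idem S := ⟨idemOf X hX, isIdempotentElem_idemOf hX⟩
    let p : Fin n → Idem S := fun i => ⟨idemOf (Y i) (hY i), isIdempotentElem_idemOf (hY i)⟩
    have hs : ∀ {Z : Set S} (hZ : IsConstructible Z),
        Idem.support ⟨idemOf Z hZ, isIdempotentElem_idemOf hZ⟩ = Z := fun {Z} hZ => by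
      ext x
      change x ∈ (idemOf Z hZ).1 x ↔ _
      rw [mem_idemOf]
      exact and_iff_right rfl
    have hU : q.support = ⋃ i, (p i).support := by simp only [q, p, hs, hXY]
    -- (R4) is the image under this homomorphism of the identity between indicator functions.
    let Φ := (CStarEnvelope.of (CcAlg S)).comp (unitsHom S)
    have hΦ : ∀ r : Idem S, algElem gpGenerator r.1 = Φ (idemInd r) := fun r => by
      rw [algElem_gpGenerator, d_idem]
      rfl
    have := congrArg Φ (prod_idemInd_sub_eq_zero hn q p hU)
    rw [map_list_prod, map_zero, List.map_ofFn] at this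
    rw [← this]
    congr 2
    funext i
    rw [Function.comp_apply, map_sub, ← hΦ, ← hΦ]

/-- Words in the generators give every `d g 1`, in particular every `idemInd p` on the unit space.
Stone–Weierstrass then gives all of C(Ω(S)), and `d_eq_mul` gives every `d g φ`. These span C_c,
which is dense in its completion. -/
theorem adjoin_gpGenerator_dense :
    (StarAlgebra.adjoin ℂ (Set.range (gpGenerator : S → FullGPAlgebra S))).topologicalClosure =
      ⊤ := by
  set A := (StarAlgebra.adjoin ℂ (Set.range (gpGenerator : S → FullGPAlgebra S))).topologicalClosure
    with hA
  have hclosed : IsClosed (A : Set (FullGPAlgebra S)) :=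
    StarSubalgebra.isClosed_topologicalClosure _
  have hgen : ∀ s, gpGenerator s ∈ A := fun s =>
    StarSubalgebra.le_topologicalClosure _ (StarAlgebra.subset_adjoin ℂ _ ⟨s, rfl⟩)
  have hg : ∀ g : LeftHull S, CStarEnvelope.of (CcAlg S) (d g 1) ∈ A := fun g => by
    obtain ⟨l, rfl⟩ := exists_hullWord g
    rw [← algWord_gpGenerator]
    refine list_prod_mem fun x hx => ?_
    obtain ⟨y, -, rfl⟩ := List.mem_map.1 hx
    exact mul_mem (star_mem (hgen _)) (hgen _)
  let Φ := (CStarEnvelope.of (CcAlg S)).comp (unitsHom S)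
  have hΦ : ∀ φ, Φ φ ∈ A := fun φ => by
    induction φ using continuousMap_omega_induction with
    | hc => exact hclosed.preimage (map_continuous Φ)
    | hind p =>
      have : Φ (idemInd p) = CStarEnvelope.of (CcAlg S) (d p.1 1) := by rw [d_idem]; rfl
      rw [this]
      exact hg p.1
    | halg c => rw [AlgHomClass.commutes]; exact algebraMap_mem A c
    | hadd φ ψ h h' => rw [map_add]; exact add_mem h h'
    | hmul φ ψ h h' => rw [_root_.map_mul]; exact mul_mem h h'
  have hof : ∀ f : CcAlg S, CStarEnvelope.of (CcAlg S) f ∈ A := fun f => by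
    induction f using CcAlg.induction with
    | hd g φ => rw [d_eq_mul, _root_.map_mul]; exact mul_mem (hg g) (hΦ φ)
    | h0 => rw [map_zero]; exact zero_mem A
    | hadd f f' h h' => rw [map_add]; exact add_mem h h'
    | hsmul c f h => rw [map_smul]; exact A.smul_mem h c
  rw [eq_top_iff]
  intro x _
  exact (maxCStarSeminorm (CcAlg S)).induction (P := fun x => x ∈ A) x hclosed hof

end Generators

open CcAlg

/-! ### Representations from the relations -/

section Universal

variable {S : Type u} [LeftCancelMonoid S]

theorem pull_add (g : LeftHull S) (φ ψ : C(omega S, ℂ)) :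
    pull g (φ + ψ) = pull g φ + pull g ψ := by
  ext χ
  by_cases h : χ.1.1 (dom g) = true
  · simp [pull_pos _ h]
  · simp [pull_neg _ h]

theorem pull_smul (g : LeftHull S) (c : ℂ) (φ : C(omega S, ℂ)) :
    pull g (c • φ) = c • pull g φ := by
  ext χ
  by_cases h : χ.1.1 (dom g) = true
  · simp [pull_pos _ h]
  · simp [pull_neg _ h]

/-- Pulling back along a partial map and extending by zero is norm-decreasing. Continuity is needed
to pass covariance from the algebra generated by indicators to its closure. -/
theorem continuous_pull (g : LeftHull S) : Continuous (pull g) := by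
  let L : C(omega S, ℂ) →ₗ[ℂ] C(omega S, ℂ) :=
    { toFun := pull g, map_add' := pull_add g, map_smul' := pull_smul g }
  refine AddMonoidHomClass.continuous_of_bound L 1 fun φ => ?_
  rw [one_mul]
  refine (ContinuousMap.norm_le _ (norm_nonneg φ)).2 fun χ => ?_
  change ‖pull g φ χ‖ ≤ _
  by_cases h : χ.1.1 (dom g) = true
  · rw [pull_pos _ h]
    exact φ.norm_coe_le_norm _
  · rw [pull_neg _ h, norm_zero]
    exact norm_nonneg φ

namespace HullRelations

variable {B : Type w} [CStarAlgebra B] {v : S → B}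

/-- The relations give a representation of the continuous functions on `Ω(S)`. -/
theorem exists_unitsRep (hv : HullRelations v) :
    ∃ π : C(omega S, ℂ) →⋆ₐ[ℂ] B, ∀ p, π (idemInd p) = algElem v p.1 := by
  obtain ⟨K, _, _, J, hJ, f, hf⟩ := exists_injective_continuousMap_hom
    (fun p : Idem S => algElem v p.1) hv.star_algElem_idem hv.algElem_idem_comm
  have hmul : ∀ p q, f (p * q) = f p * f q := fun p q => hJ (by
    rw [_root_.map_mul, hf, hf, hf, hv.algElem_idem_mul])
  have hone : f 1 = 1 := hJ (by rw [hf, _root_.map_one]; exact hv.algElem_one)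
  -- Each `f p` is idempotent, so it takes only the values 0 and 1.
  have h01 : ∀ p k, f p k ≠ 1 → f p k = 0 := fun p k h => by
    have e : p * p = p := Subtype.ext p.2
    have := congrArg (fun F : C(K, ℂ) => F k) (hmul p p)
    simp only [e, ContinuousMap.mul_apply] at this
    by_contra h0
    exact h (mul_left_cancel₀ h0 (this.symm.trans (mul_one _).symm))
  classical
  -- Evaluating the projections v_p at a point of K gives a semi-character.
  let X : K → semiChars S := fun k => ⟨fun p => decide (f p k = 1), fun p q => by
    rw [Bool.eq_iff_iff, Bool.and_eq_true, decide_eq_true_eq, decide_eq_true_eq,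
      decide_eq_true_eq, hmul, ContinuousMap.mul_apply]
    by_cases hp : f p k = 1
    · simp [hp]
    · simp [h01 p k hp], 1, by simp [hone]⟩
  have hX : ∀ k p, (X k).1 p = true ↔ f p k = 1 := fun k p => decide_eq_true_iff
  -- The points of K land in Ω(S) by the relations: a forbidden finite cover contradicts (R3) if it
  -- is empty and (R4) otherwise.
  have hXΩ : ∀ k, X k ∈ omega S := fun k => by
    refine semiChars.mem_omega_of_forall fun q n p hq hp => ?_
    rw [hX] at hq
    replace hp : ∀ i, f (p i) k = 0 := fun i => h01 _ _ fun h => hp i ((hX k _).2 h)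
    by_contra! hcov
    rcases Nat.eq_zero_or_pos n with rfl | hn
    · have hbot : q.1.1 = ⊥ := LeftHull.eq_bot_iff.2 fun x y hy => by
        obtain rfl := q.eq_of_mem hy
        obtain ⟨i, -⟩ := hcov x hy
        exact i.elim0
      have : f q = 0 := hJ (by rw [hf, hv.zero _ hbot, map_zero])
      rw [this] at hq
      exact zero_ne_one hq
    · have h0 : (List.ofFn fun i => f q - f (q * p i)).prod = 0 := hJ (by
        rw [map_list_prod, List.map_ofFn, map_zero, ← hv.prod_sub_eq_zero hn q p hcov]
        congr 2
        funext i
        rw [Function.comp_apply, map_sub, hf, hf])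
      have := congrArg (fun F : C(K, ℂ) => F k) h0
      -- At k each factor equals 1 - 1 · 0 = 1, so the vanishing product would give 1 = 0.
      simp [List.prod_ofFn, ContinuousMap.prod_apply, hmul, hp, hq] at this
  let Y : C(K, omega S) := ⟨fun k => ⟨X k, hXΩ k⟩, by
    refine (Continuous.subtype_mk (continuous_pi fun p => ?_) _).subtype_mk _
    refine continuous_discrete_rng.2 fun b => ?_
    have hclopen : IsClopen {k | f p k = 1} := by
      refine ⟨isClosed_eq (f p).continuous continuous_const, ?_⟩
      have : {k | f p k = 1} = {k | f p k = 0}ᶜ := by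
        ext k
        refine ⟨fun (h : f p k = 1) (h' : f p k = 0) => one_ne_zero (h.symm.trans h'), fun h => ?_⟩
        by_contra h'
        exact h (h01 p k h')
      rw [this]
      exact (isClosed_eq (f p).continuous continuous_const).isOpen_compl
    cases b
    · convert! hclopen.compl.isOpen using 1
      ext k
      simp
    · convert! hclopen.isOpen using 1
      ext k
      simp⟩
  -- π is composition with K → Ω(S) followed by the Gelfand embedding into `B`.
  refine ⟨J.comp (ContinuousMap.compStarAlgHom' ℂ ℂ Y), fun p => ?_⟩
  rw [← hf, StarAlgHom.comp_apply]
  congr 1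
  ext k
  change idemInd p (Y k) = f p k
  by_cases h : f p k = 1
  · rw [h, idemInd_pos ((hX k p).2 h)]
  · rw [h01 p k h, idemInd_neg fun h' => h ((hX k p).1 h')]

/-- Covariance: `π(φ) v_h = v_h π(φ ∘ h)`. -/
theorem rep_mul_algElem (hv : HullRelations v) {π : C(omega S, ℂ) →⋆ₐ[ℂ] B}
    (hπ : ∀ p, π (idemInd p) = algElem v p.1) (h : LeftHull S) (φ : C(omega S, ℂ)) :
    π φ * algElem v h = algElem v h * π (pull h φ) := by
  have hc : Continuous π := map_continuous π
  induction φ using continuousMap_omega_induction with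
  | hc =>
    exact isClosed_eq (hc.mul continuous_const)
      (continuous_const.mul (hc.comp (continuous_pull h)))
  | hind p => rw [pull_idemInd, hπ, hπ, ← hv.algElem_mul, ← hv.algElem_mul, Idem.mul_conj]
  | halg c =>
    -- The pull-back is not unital: 1 becomes the indicator of the domain of h. This is harmless
    -- since v_h absorbs the corresponding projection.
    have h1 : pull h 1 = idemInd (dom h) := by
      ext χ
      by_cases hχ : χ.1.1 (dom h) = true
      · rw [pull_pos _ hχ, idemInd_pos hχ, ContinuousMap.one_apply]
      · rw [pull_neg _ hχ, idemInd_neg hχ]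
    rw [Algebra.algebraMap_eq_smul_one, pull_smul, map_smul, map_smul, h1, hπ, _root_.map_one,
      mul_smul_comm, hv.algElem_mul_dom, smul_mul_assoc, one_mul]
  | hadd φ ψ h1 h2 => rw [pull_add, map_add, map_add, add_mul, mul_add, h1, h2]
  | hmul φ ψ h1 h2 =>
    rw [pull_mul, _root_.map_mul, _root_.map_mul, mul_assoc, h2, ← mul_assoc, h1, mul_assoc]

/-- A linear relation between the functions `delta g φ` holds for the elements `v_g π(φ)`. -/
theorem sum_algElem_mul_rep_eq_zero (hv : HullRelations v) {π : C(omega S, ℂ) →⋆ₐ[ℂ] B}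
    (hπ : ∀ p, π (idemInd p) = algElem v p.1) (I : Finset (LeftHull S))
    (φ : LeftHull S → C(omega S, ℂ)) (hφ : ∑ g ∈ I, d g (φ g) = 0) :
    ∑ g ∈ I, algElem v g * π (φ g) = 0 := by
  classical
  let Λ : LeftHull S → C(omega S, ℂ) →L[ℂ] B := fun g =>
    (ContinuousLinearMap.mul ℂ B (algElem v g)).comp
      ⟨π.toAlgHom.toLinearMap, (map_continuous π : Continuous π)⟩
  have hΛ : ∀ g ψ, Λ g ψ = algElem v g * π ψ := fun g ψ => rfl
  have hφγ : ∀ γ : GP S, ∑ g ∈ I, delta g (φ g) γ = 0 := fun γ => by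
    let ev : CcAlg S →+ ℂ :=
      { toFun := fun f => f.1 γ, map_zero' := rfl, map_add' := fun _ _ => rfl }
    have := congrArg ev hφ
    rwa [map_sum, map_zero] at this
  refine sum_apply_eq_zero_of_locally I φ Λ fun χ => ?_
  -- `c g` is the germ of g at χ, with `none` when χ is outside the domain of g. Its fibres group
  -- the terms of the sum.
  let c : LeftHull S → Option (GP S) := fun g =>
    if h : χ.1.1 (dom g) = true then some (germ g χ h) else none
  have hc : ∀ {g} (h : χ.1.1 (dom g) = true), c g = some (germ g χ h) := fun h => dif_pos h
  -- Elements with the same germ at χ agree on some idempotent p with χ(p) = 1; for all other pairs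
  -- the default 1 is used. Multiplying over the finitely many pairs yields one p that serves for
  -- all of them.
  have hpair : ∀ a b : LeftHull S, ∃ p : Idem S, χ.1.1 p = true ∧
      (χ.1.1 (dom a) = true → c a = c b → a * p.1 = b * p.1) := fun a b => by
    by_cases h : χ.1.1 (dom a) = true ∧ c a = c b
    · obtain ⟨ha, hab⟩ := h
      have hb : χ.1.1 (dom b) = true := by
        by_contra hb
        rw [hc ha] at hab
        simp [c, hb] at hab
      rw [hc ha, hc hb, Option.some_inj] at hab
      obtain ⟨-, p, hp, hχp⟩ := GP.germ_eq_iff.1 hab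
      exact ⟨p, hχp, fun _ _ => hp⟩
    · exact ⟨1, semiChars.map_one χ.1, fun h1 h2 => absurd ⟨h1, h2⟩ h⟩
  choose P hP hP' using hpair
  have hprod : ∀ J : Finset (LeftHull S × LeftHull S), ∃ p : Idem S, χ.1.1 p = true ∧
      ∀ x ∈ J, P x.1 x.2 * p = p := fun J => by
    induction J using Finset.induction_on with
    | empty => exact ⟨1, semiChars.map_one χ.1, by simp⟩
    | insert x J _ ih =>
      obtain ⟨p, hp, hpJ⟩ := ih
      refine ⟨P x.1 x.2 * p, (map_mul_iff _ _ _).2 ⟨hP _ _, hp⟩, fun y hy => ?_⟩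
      rcases Finset.mem_insert.1 hy with rfl | hy
      · exact Idem.ext' fun z => by simp only [mem_mul_iff]; tauto
      · have := hpJ y hy
        refine Idem.ext' fun z => ?_
        have hz := congrArg (fun q : Idem S => z ∈ q.1.1 z) this
        simp only [mem_mul_iff, eq_iff_iff] at hz ⊢
        tauto
  obtain ⟨p, hχp, hp⟩ := hprod (I ×ˢ I)
  -- On this neighbourhood of χ the common p equals 1, and it avoids the domain of every g in `I`
  -- that is not defined at χ.
  let U : Set (omega S) := {ψ | ψ.1.1 p = true} ∩
    ⋂ g ∈ I.filter fun g => ¬ χ.1.1 (dom g) = true, {ψ : omega S | ψ.1.1 (dom g) = true}ᶜ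
  refine ⟨U, (isClopen_domΩ p).isOpen.inter (isOpen_biInter_finset fun g _ =>
    (isClopen_domΩ (dom g)).compl.isOpen), ⟨hχp, Set.mem_iInter₂.2 fun g hg =>
      (Finset.mem_filter.1 hg).2⟩, fun h hh => ?_⟩
  have hhp : π h = algElem v p.1 * π h := by
    rw [← hπ, ← _root_.map_mul]
    congr 1
    ext ψ
    rw [ContinuousMap.mul_apply]
    by_cases hψ : ψ.1.1 p = true
    · rw [idemInd_pos hψ, one_mul]
    · rw [hh ψ fun hψU => hψ hψU.1, mul_zero]
  have hnone : ∀ g ∈ I, ¬ χ.1.1 (dom g) = true → Λ g h = 0 := fun g hg hχg => by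
    have : idemInd (dom g) * h = 0 := by
      ext ψ
      rw [ContinuousMap.mul_apply, ContinuousMap.zero_apply]
      by_cases hψ : ψ.1.1 (dom g) = true
      · rw [hh ψ fun hψU => Set.mem_iInter₂.1 hψU.2 g (Finset.mem_filter.2 ⟨hg, hχg⟩) hψ, mul_zero]
      · rw [idemInd_neg hψ, zero_mul]
    rw [hΛ, ← hv.algElem_mul_dom, mul_assoc, ← hπ, ← _root_.map_mul, this, map_zero, mul_zero]
  -- Since π(h) = v_p π(h), only the restriction of an element to p matters, and elements with the
  -- same germ have the same restriction.
  have hsame : ∀ a ∈ I, ∀ b ∈ I, χ.1.1 (dom a) = true → c a = c b → Λ a h = Λ b h :=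
    fun a ha b hb hχa hab => by
      have e : a * p.1 = b * p.1 := by
        rw [← hp (a, b) (Finset.mk_mem_product ha hb)]
        change a * ((P a b).1 * p.1) = b * ((P a b).1 * p.1)
        rw [← mul_assoc, ← mul_assoc, hP' a b hχa hab]
      rw [hΛ, hΛ, hhp, ← mul_assoc, ← mul_assoc, ← hv.algElem_mul, ← hv.algElem_mul, e]
  -- It suffices that the terms sharing a germ cancel among themselves.
  refine Finset.sum_cancels_of_partition_cancels (Setoid.ker c) fun g hg => ?_
  by_cases hχg : χ.1.1 (dom g) = true
  · have e : ∀ a ∈ I.filter fun a => (Setoid.ker c) a g,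
        φ a χ • Λ a h = delta a (φ a) (germ g χ hχg) • Λ g h := fun a ha => by
      obtain ⟨haI, hac⟩ := Finset.mem_filter.1 ha
      replace hac : c a = c g := hac
      have hχa : χ.1.1 (dom a) = true := by
        by_contra hχa
        rw [hc hχg] at hac
        simp [c, hχa] at hac
      rw [hsame a haI g hg hχa hac]
      rw [hc hχa, hc hχg, Option.some_inj] at hac
      rw [← hac, delta_germ]
    -- The coefficients add up to the value at [g, χ] of the full sum of the functions, which is
    -- zero. Terms outside the group contribute nothing, because D(a, Ω(S)) contains [g, χ] only if
    -- a has that germ at χ.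
    rw [Finset.sum_congr rfl e, ← Finset.sum_smul, Finset.sum_filter_of_ne, hφγ, zero_smul]
    intro a _ hne
    obtain ⟨χ', hχ', e⟩ := mem_of_delta_ne hne
    obtain ⟨rfl, -⟩ := GP.germ_eq_iff.1 e
    change c a = c g
    rw [hc hχ', hc hχg, e]
  · refine Finset.sum_eq_zero fun a ha => ?_
    obtain ⟨haI, hac⟩ := Finset.mem_filter.1 ha
    replace hac : c a = c g := hac
    rw [hnone a haI, smul_zero]
    intro hχa
    rw [hc hχa] at hac
    simp [c, hχg] at hac

/-- The relations give a representation of the *-algebra `C_c(𝒢_P(S))`. -/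
theorem exists_rep (hv : HullRelations v) :
    ∃ ρ : CcAlg S →⋆ₐ[ℂ] B, ∀ g, ρ (d g 1) = algElem v g := by
  obtain ⟨π, hπ⟩ := hv.exists_unitsRep
  -- Formal sums of pairs (g, φ) map onto C_c by `L` and into `B` by `T`. Since `T` kills the kernel
  -- of `L`, it descends to C_c, here by means of a linear section `r` of `L`.
  let L : (LeftHull S →₀ C(omega S, ℂ)) →ₗ[ℂ] CcAlg S := Finsupp.lsum ℂ fun g =>
    { toFun := d g, map_add' := d_add g, map_smul' := d_smul g }
  let T : (LeftHull S →₀ C(omega S, ℂ)) →ₗ[ℂ] B := Finsupp.lsum ℂ fun g =>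
    (LinearMap.mulLeft ℂ (algElem v g)).comp π.toAlgHom.toLinearMap
  have hLs : ∀ g φ, L (Finsupp.single g φ) = d g φ := fun g φ => Finsupp.lsum_single _ _ _ _
  have hTs : ∀ g φ, T (Finsupp.single g φ) = algElem v g * π φ :=
    fun g φ => Finsupp.lsum_single _ _ _ _
  have hker : ∀ x, L x = 0 → T x = 0 := fun x hx =>
    hv.sum_algElem_mul_rep_eq_zero hπ x.support x hx
  have hsurj : LinearMap.range L = ⊤ := by
    refine eq_top_iff.2 fun f hf => ?_
    clear hf
    induction f using CcAlg.induction with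
    | hd g φ => exact ⟨_, hLs g φ⟩
    | h0 => exact zero_mem _
    | hadd f f' h h' => exact add_mem h h'
    | hsmul c f h => exact Submodule.smul_mem _ c h
  obtain ⟨r, hr⟩ := L.exists_rightInverse_of_surjective hsurj
  let R : CcAlg S →ₗ[ℂ] B := T.comp r
  have hR : ∀ g φ, R (d g φ) = algElem v g * π φ := fun g φ => by
    rw [← hTs, ← sub_eq_zero]
    change T (r (d g φ)) - _ = 0
    rw [← map_sub]
    apply hker
    have : L (r (d g φ)) = d g φ := LinearMap.congr_fun hr (d g φ)
    rw [map_sub, this, hLs, sub_self]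
  have hmul : ∀ f f', R (f * f') = R f * R f' := fun f f' => by
    induction f using CcAlg.induction with
    | hd g φ =>
      induction f' using CcAlg.induction with
      | hd h ψ =>
        rw [d_mul, hR, hR, hR, hv.algElem_mul, _root_.map_mul]
        calc algElem v g * algElem v h * (π (pull h φ) * π ψ)
            = algElem v g * (algElem v h * π (pull h φ)) * π ψ := by simp only [mul_assoc]
          _ = algElem v g * π φ * (algElem v h * π ψ) := by
            -- Covariance moves π(φ) past v_h, matching the convolution formula for `d g φ * d h ψ`.
            rw [← hv.rep_mul_algElem hπ]; simp only [mul_assoc]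
      | h0 => rw [mul_zero, map_zero, mul_zero]
      | hadd f f' h h' => rw [mul_add, map_add, map_add, mul_add, h, h']
      | hsmul c f h => rw [mul_smul_comm, map_smul, map_smul, mul_smul_comm, h]
    | h0 => rw [zero_mul, map_zero, zero_mul]
    | hadd f f'' h h' => rw [add_mul, map_add, map_add, add_mul, h, h']
    | hsmul c f h => rw [smul_mul_assoc, map_smul, map_smul, smul_mul_assoc, h]
  have hone : R 1 = 1 := by
    change R (d 1 1) = 1
    rw [hR, hv.algElem_one, _root_.map_one, mul_one]
  have hstar : ∀ f, R (star f) = star (R f) := fun f => by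
    induction f using CcAlg.induction with
    -- Covariance again: (v_g π(φ))* = π(φ*) v_{g⁻¹}, and moving π(φ*) to the right pulls φ* back
    -- along g⁻¹.
    | hd g φ => rw [d_star, hR, hR, ← hv.rep_mul_algElem hπ, star_mul, hv.algElem_inv, map_star]
    | h0 => rw [star_zero, map_zero, star_zero]
    | hadd f f' h h' => rw [star_add, map_add, map_add, star_add, h, h']
    | hsmul c f h => rw [star_smul, map_smul, map_smul, star_smul, h]
  refine ⟨{ AlgHom.ofLinearMap R hone hmul with map_star' := hstar }, fun g => ?_⟩
  change R (d g 1) = _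
  rw [hR, _root_.map_one, mul_one]

end HullRelations

end Universal

/-! ### The universal property -/

theorem mainTheorem12 (S : Type u) [LeftCancelMonoid S] [Countable S] :
    HullRelations (gpGenerator : S → FullGPAlgebra S) ∧
    (StarAlgebra.adjoin ℂ (Set.range (gpGenerator : S → FullGPAlgebra S))).topologicalClosure = ⊤ ∧
    ∀ (B : Type w) [CStarAlgebra B] (b : S → B), HullRelations b →
      ∃! φ : FullGPAlgebra S →⋆ₐ[ℂ] B, ∀ s : S, φ (gpGenerator s) = b s := by
  refine ⟨hullRelations_gpGenerator, adjoin_gpGenerator_dense, fun B _ b hb => ?_⟩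
  obtain ⟨ρ, hρ⟩ := hb.exists_rep
  obtain ⟨φ, hφ⟩ := CStarEnvelope.exists_lift ρ
  have hgen : ∀ s, φ (gpGenerator s) = b s := fun s => by
    rw [gpGenerator_eq, hφ, hρ, hb.algElem_tr]
  refine ⟨φ, hgen, fun ψ hψ => ?_⟩
  have hcφ : Continuous φ := map_continuous φ
  have hcψ : Continuous ψ := map_continuous ψ
  -- Two homomorphisms with the same values on the generators agree on the *-algebra they generate.
  -- Homomorphisms of C*-algebras are continuous, so they agree on its closure, which is everything.
  have hadj : Set.EqOn ψ φ
      (StarAlgebra.adjoin ℂ (Set.range (gpGenerator : S → FullGPAlgebra S))) := fun x hx => by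
    induction hx using StarAlgebra.adjoin_induction with
    | mem x h => obtain ⟨s, rfl⟩ := h; rw [hψ, hgen]
    | algebraMap c => rw [AlgHomClass.commutes, AlgHomClass.commutes]
    | add x y _ _ hx hy => rw [map_add, map_add, hx, hy]
    | mul x y _ _ hx hy => rw [_root_.map_mul, _root_.map_mul, hx, hy]
    | star x _ hx => rw [map_star, map_star, hx]
  refine StarAlgHom.ext fun x => hadj.closure hcψ hcφ ?_
  rw [← StarSubalgebra.topologicalClosure_coe, adjoin_gpGenerator_dense]
  trivial
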